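/- Theorem 3. Let $U=\{x\in\mathbb{R}^2:\|x\|\le 1\}$ be the unit disc. A set $B\subset\mathbb{R}^2$ is a straight barrier for $U$ if it is a finite union of line segments and every line that intersects $U$ also intersects $B$; let $|B|$ denote its length (one-dimensional Hausdorff measure). Let $B$ be a straight barrier for $U$ and put $\delta=|B|-\pi$. Then for all real $r,t$ with $$0<r<\frac{1}{\cos\frac{\pi}{8}}-1,\qquad \cos\tfrac{\pi}{8}\,(1+r)<t\le 1,$$ the following holds. If $$\eta'=\tfrac12\Bigl(1-t-\tfrac{1+r}{r}\,\delta\Bigr)\ge 0,$$ then $$4(1+r)\bigl(1+(h')^2\bigr)\,\delta\ \ge\ (\eta')^2,$$ where $$h'=\frac{\eta'+2t\cos\frac{\pi}{8}+2w\sin\frac{\pi}{8}}{2t\sin\frac{\pi}{8}-2w\cos\frac{\pi}{8}},\qquad w=\sqrt{(1+r)^2-t^2}.$$ -/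

import Mathlib

open MeasureTheory

/-- The Euclidean plane `ℝ²`. -/
abbrev Plane : Type := EuclideanSpace ℝ (Fin 2)

/-- The closed unit disc centred at the origin. -/
def unitDisc : Set Plane := Metric.closedBall 0 1

/-- A set `ℓ` in the plane is a line if it is a one-dimensional affine subspace. -/
def IsLine (ℓ : AffineSubspace ℝ Plane) : Prop := Module.finrank ℝ ℓ.direction = 1

/-- `B` is a barrier (opaque set) for `K`: every line that intersects `K` also intersects `B`. -/
def IsBarrier (K B : Set Plane) : Prop :=
  ∀ ℓ : AffineSubspace ℝ Plane, IsLine ℓ →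
    ((ℓ : Set Plane) ∩ K).Nonempty → ((ℓ : Set Plane) ∩ B).Nonempty

/-- `B` is straight: it is a finite union of (closed) line segments. -/
def IsStraight (B : Set Plane) : Prop :=
  ∃ S : Finset (Plane × Plane), B = ⋃ s ∈ S, segment ℝ s.1 s.2

/-- A straight barrier for `K`. -/
def IsStraightBarrier (K B : Set Plane) : Prop := IsStraight B ∧ IsBarrier K B

/-- The length `|B|` of a subset of the plane: its one-dimensional Hausdorff measure
(normalized so that the measure of a segment is the distance of its endpoints).
It is finite for straight sets, see `IsStraight.length_ne_top`. -/
noncomputable def planeLength (B : Set Plane) : ℝ := (μH[1] B).toReal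

theorem IsStraight.length_ne_top {B : Set Plane} (hB : IsStraight B) : μH[1] B ≠ ⊤ := by
  obtain ⟨S, rfl⟩ := hB
  refine ((measure_biUnion_finset_le S _).trans_lt ?_).ne
  refine ENNReal.sum_lt_top.2 fun s _ => ?_
  rw [hausdorffMeasure_segment]
  exact edist_lt_top _ _

/-! Cover the barrier by finitely many segments of one small length `e`. For a direction θ, the
shadows (projections) of the segments cover the interval [-1, 1]; the excess of their total length
over 2 is the waste at θ. It is nonnegative, and its integral over a half turn is twice the excess
of total length over π. So every unavoidable waste bounds δ from below.

There are two sources of waste. A segment with centre outside the disc of radius R = 1 + r has a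
shadow off [-1, 1] for many directions (`CoversDisc.card_outside_le`). Hence a cap cut off at height
t, which needs length about 1 - t, keeps at least 1 - t - (1 + r)δ/r within radius R; this is 2η'.
The other source is two families in different caps whose shadows pass through each other as θ turns:
wherever they overlap, length is lost (`CoversDisc.facing_le`).

Overlaps inside one family would spoil the count of crossings. So the shadows of each family are
read as jobs arriving at a single server. Serving them one at a time only enlarges the covered set,
makes the intervals disjoint and preserves Lipschitz bounds. Then each of the n² pairs of jobs
crosses at relative speed at most D, which costs e²/D, and all pairs together cost (ne)²/D
(`sq_div_le_integral_waste`).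

The shadows must not shrink too much, so directions nearly orthogonal to the crossing direction are
discarded. A segment is nearly orthogonal to at most one of the four directions jπ/4, so every cap
is rich (holds length η' of usable segments) for at least three of them. A pigeonhole over four caps
at right angles yields two opposite or two adjacent caps rich for the direction in which their
shadows coincide. The angular half-width of a cap is below π/8, so a turn through some φ < π/8
separates the shadows, and usable shadows keep the factor sin(π/8 - φ). The optimal φ gives h' =
cot(π/8 - φ). Finally `e` tends to 0. -/

/-! ### Single-server queues and the overlap of two families of intervals -/

/-- The start times of service in a single-server queue with arrival times `x` and constant
service time `e`, ordered increasingly. -/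
noncomputable def queueStart {n : ℕ} (e : ℝ) (x : Fin n → ℝ) (k : Fin n) : ℝ :=
  (Finset.Iic k).sup' Finset.nonempty_Iic
    (fun j => (x ∘ Tuple.sort x) j + ((k : ℝ) - (j : ℝ)) * e)

/-- Order statistics are determined by counting entries below a level, and the hypothesis makes
these counts comparable. -/
theorem sort_le_sort_add {n : ℕ} {x y : Fin n → ℝ} {c : ℝ} (h : ∀ i, x i ≤ y i + c) (k : Fin n) :
    (x ∘ Tuple.sort x) k ≤ (y ∘ Tuple.sort y) k + c := by
  classical
  rw [← Tuple.lt_card_le_iff_apply_le_of_monotone (Tuple.monotone_sort x)]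
  have h1 := (Tuple.lt_card_le_iff_apply_le_of_monotone (j := k) (a := (y ∘ Tuple.sort y) k)
    (Tuple.monotone_sort y)).2 le_rfl
  have key : ∀ (f : Fin n → ℝ) (a : ℝ),
      (Finset.univ.filter fun i => (f ∘ Tuple.sort f) i ≤ a).card =
        (Finset.univ.filter fun i => f i ≤ a).card := by
    intro f a
    refine Finset.card_bij (fun i _ => Tuple.sort f i) ?_ ?_ ?_
    · intro i hi; simpa using hi
    · intro i _ j _ hij; exact (Tuple.sort f).injective hij
    · intro i hi
      exact ⟨(Tuple.sort f).symm i, by simpa using hi, by simp⟩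
  rw [key] at h1 ⊢
  refine h1.trans_le (Finset.card_le_card ?_)
  intro i hi
  simp only [Finset.mem_filter, Finset.mem_univ, true_and] at hi ⊢
  linarith [h i]

/-- Start times are monotone and commute with shifts, so they are 1-Lipschitz in the sup norm; the
speed bounds of the shadows pass to the queue. -/
theorem queueStart_le_add {n : ℕ} {e : ℝ} {x y : Fin n → ℝ} {c : ℝ} (h : ∀ i, x i ≤ y i + c)
    (k : Fin n) : queueStart e x k ≤ queueStart e y k + c := by
  unfold queueStart
  refine Finset.sup'_le _ _ fun j hj => ?_
  have := Finset.le_sup' (fun j => (y ∘ Tuple.sort y) j + ((k : ℝ) - (j : ℝ)) * e) hj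
  have h2 := sort_le_sort_add h j
  beta_reduce at this
  linarith

theorem queueStart_add_le {n : ℕ} {e : ℝ} (x : Fin n → ℝ) {k l : Fin n} (hkl : k ≤ l) :
    queueStart e x k + ((l : ℝ) - k) * e ≤ queueStart e x l := by
  rw [← le_sub_iff_add_le]
  unfold queueStart
  refine Finset.sup'_le _ _ fun j hj => ?_
  have hj' : j ∈ Finset.Iic l := Finset.mem_Iic.2 ((Finset.mem_Iic.1 hj).trans hkl)
  have := Finset.le_sup' (fun j => (x ∘ Tuple.sort x) j + ((l : ℝ) - (j : ℝ)) * e) hj'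
  beta_reduce at this
  linarith

theorem le_queueStart {n : ℕ} {e : ℝ} (x : Fin n → ℝ) {c : ℝ} (h : ∀ i, c ≤ x i) (k : Fin n) :
    c ≤ queueStart e x k := by
  unfold queueStart
  have := Finset.le_sup' (fun j => (x ∘ Tuple.sort x) j + ((k : ℝ) - (j : ℝ)) * e)
    (Finset.mem_Iic.2 (le_refl k))
  simp only [sub_self, zero_mul, add_zero] at this
  exact (h _).trans this

/-- The worst case is that all jobs arrive at `c`. This decides how far two families must be apart
for their queues to be disjoint. -/
theorem queueStart_le {n : ℕ} {e : ℝ} (he : 0 ≤ e) (x : Fin n → ℝ) {c : ℝ} (h : ∀ i, x i ≤ c)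
    (k : Fin n) : queueStart e x k + e ≤ c + n * e := by
  rw [← le_sub_iff_add_le]
  unfold queueStart
  refine Finset.sup'_le _ _ fun j hj => ?_
  have hk : (k : ℝ) + 1 ≤ n := by exact_mod_cast k.2
  have hj0 : (0 : ℝ) ≤ (j : ℝ) := by positivity
  have := h (Tuple.sort x j)
  simp only [Function.comp_apply]
  nlinarith [mul_nonneg hj0 he, mul_le_mul_of_nonneg_right hk he]

/-- Serving the queue keeps the server busy whenever one of the original intervals is running. -/
theorem iUnion_Ico_subset_queue {n : ℕ} {e : ℝ} (he : 0 < e) (x : Fin n → ℝ) :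
    (⋃ i, Set.Ico (x i) (x i + e)) ⊆
      ⋃ k, Set.Ico (queueStart e x k) (queueStart e x k + e) := by
  intro s hs
  obtain ⟨i, hi⟩ := Set.mem_iUnion.1 hs
  obtain ⟨j, rfl⟩ := (Tuple.sort x).surjective i
  set xs := x ∘ Tuple.sort x with hxs
  have hmono : Monotone xs := Tuple.monotone_sort x
  have hj : xs j ≤ queueStart e x j := by
    have := Finset.le_sup' (fun i => xs i + ((j : ℝ) - (i : ℝ)) * e)
      (Finset.mem_Iic.2 (le_refl j))
    rw [sub_self, zero_mul, add_zero] at this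
    exact this
  by_cases hs1 : queueStart e x j ≤ s
  · refine Set.mem_iUnion.2 ⟨j, hs1, hi.2.trans_le ?_⟩
    simp only [hxs, Function.comp_apply] at hj
    linarith
  -- Job `j` is still waiting at time `s`. The job `i0` attaining the supremum opens the busy period
  -- of `j`; from its arrival on the server never idles, so at `s` it serves job `i0 + d`.
  · push Not at hs1
    obtain ⟨i0, hi0, hval⟩ := Finset.exists_mem_eq_sup' (s := Finset.Iic j)
      Finset.nonempty_Iic (fun i => xs i + ((j : ℝ) - (i : ℝ)) * e)
    have hij : i0 ≤ j := Finset.mem_Iic.1 hi0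
    have hval' : queueStart e x j = xs i0 + ((j : ℝ) - (i0 : ℝ)) * e := hval
    have hxs0 : xs i0 ≤ s := (hmono hij).trans hi.1
    set d := ⌊(s - xs i0) / e⌋₊ with hd
    have hd0 : 0 ≤ (s - xs i0) / e := div_nonneg (by linarith) he.le
    have hd1 : (d : ℝ) * e ≤ s - xs i0 := by
      rw [← le_div_iff₀ he]; exact Nat.floor_le hd0
    have hd2 : s - xs i0 < ((d : ℝ) + 1) * e := by
      rw [← div_lt_iff₀ he]; exact Nat.lt_floor_add_one _
    have hdj : (i0 : ℕ) + d < j := by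
      have h1 : (d : ℝ) * e < ((j : ℝ) - i0) * e := by linarith
      have h2 : (d : ℝ) < (j : ℝ) - i0 := lt_of_mul_lt_mul_right h1 he.le
      have h3 : ((i0 : ℕ) : ℝ) + d < (j : ℕ) := by linarith
      exact_mod_cast h3
    let k : Fin n := ⟨(i0 : ℕ) + d, hdj.trans j.2⟩
    have hkv : (k : ℝ) = (i0 : ℝ) + d := by simp [k]
    have hk1 : xs i0 + ((k : ℝ) - (i0 : ℝ)) * e ≤ queueStart e x k := by
      have hm : i0 ∈ Finset.Iic k := by
        rw [Finset.mem_Iic, Fin.le_def]; simp [k]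
      exact Finset.le_sup' (fun i => xs i + ((k : ℝ) - (i : ℝ)) * e) hm
    have hk2 := queueStart_add_le (e := e) x (k := k) (l := j) (by rw [Fin.le_def]; exact hdj.le)
    rw [hkv] at hk1 hk2
    refine Set.mem_iUnion.2 ⟨k, ?_, ?_⟩ <;> nlinarith

theorem pairwise_disjoint_Ico_queue {n : ℕ} {e : ℝ} (he : 0 < e) (x : Fin n → ℝ) :
    Pairwise (Function.onFun Disjoint
      fun k => Set.Ico (queueStart e x k) (queueStart e x k + e)) := by
  intro k l hkl
  wlog h : k < l generalizing k l
  · exact (this hkl.symm (lt_of_le_of_ne (not_lt.1 h) hkl.symm)).symm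
  have h1 := queueStart_add_le (e := e) x h.le
  have h2 : (1 : ℝ) ≤ (l : ℝ) - k := by
    have : (k : ℕ) + 1 ≤ l := h
    have : ((k : ℕ) : ℝ) + 1 ≤ (l : ℕ) := by exact_mod_cast this
    linarith
  refine Set.disjoint_left.2 fun s hs hs' => ?_
  have := hs.2; have := hs'.1
  nlinarith

theorem volume_real_Ico_inter_Ico {a b e : ℝ} :
    volume.real (Set.Ico a (a + e) ∩ Set.Ico b (b + e)) = max 0 (e - |a - b|) := by
  rw [Set.Ico_inter_Ico, Real.volume_real_Ico, max_comm, min_add_add_right]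
  congr 1
  rw [← max_sub_min_eq_abs']
  have := max_add_min a b
  linarith

theorem volume_real_iUnion_queue {n : ℕ} {e : ℝ} (he : 0 < e) (x : Fin n → ℝ) :
    volume.real (⋃ k, Set.Ico (queueStart e x k) (queueStart e x k + e)) = n * e := by
  rw [measureReal_iUnion_fintype (pairwise_disjoint_Ico_queue he x) (fun _ => measurableSet_Ico)
    (fun _ => by simp)]
  simp [he.le]

/-- Overlap of two families of intervals of equal length, bounded from below by the
overlaps of the intervals of the corresponding queues. -/
theorem volume_union_add_sum_le {n : ℕ} {e : ℝ} (he : 0 < e) (x y : Fin n → ℝ) :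
    volume.real ((⋃ i, Set.Ico (x i) (x i + e)) ∪ ⋃ j, Set.Ico (y j) (y j + e)) +
      ∑ k, ∑ l, max 0 (e - |queueStart e x k - queueStart e y l|) ≤ 2 * (n * e) := by
  set U := ⋃ k, Set.Ico (queueStart e x k) (queueStart e x k + e) with hU
  set V := ⋃ k, Set.Ico (queueStart e y k) (queueStart e y k + e) with hV
  have hUm : MeasurableSet U := MeasurableSet.iUnion fun _ => measurableSet_Ico
  have hVm : MeasurableSet V := MeasurableSet.iUnion fun _ => measurableSet_Ico
  have hfin : ∀ z : Fin n → ℝ, volume (⋃ k, Set.Ico (z k) (z k + e)) ≠ ⊤ := by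
    intro z
    refine ((measure_iUnion_fintype_le _ _).trans_lt (ENNReal.sum_lt_top.2 fun i _ => ?_)).ne
    simp
  have h1 : volume.real ((⋃ i, Set.Ico (x i) (x i + e)) ∪ ⋃ j, Set.Ico (y j) (y j + e)) ≤
      volume.real (U ∪ V) :=
    measureReal_mono (Set.union_subset_union (iUnion_Ico_subset_queue he x)
      (iUnion_Ico_subset_queue he y)) (measure_union_ne_top (hfin _) (hfin _))
  -- Each queue occupies measure exactly `n * e`, so all that the union loses is the overlap between
  -- the two queues.
  have h2 : volume.real (U ∪ V) + volume.real (U ∩ V) = volume.real U + volume.real V :=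
    measureReal_union_add_inter hVm (hfin _) (hfin _)
  have h3 : volume.real (U ∩ V) =
      ∑ k, ∑ l, max 0 (e - |queueStart e x k - queueStart e y l|) := by
    rw [hU, Set.iUnion_inter, measureReal_iUnion_fintype ?_ ?_ ?_]
    · refine Finset.sum_congr rfl fun k _ => ?_
      rw [hV, Set.inter_iUnion, measureReal_iUnion_fintype ?_ ?_ ?_]
      · exact Finset.sum_congr rfl fun l _ => volume_real_Ico_inter_Ico
      · intro i j hij
        exact (pairwise_disjoint_Ico_queue he y hij).mono Set.inter_subset_right
          Set.inter_subset_right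
      · exact fun _ => measurableSet_Ico.inter measurableSet_Ico
      · exact fun i => measure_ne_top_of_subset Set.inter_subset_left (by simp)
    · intro i j hij
      exact (pairwise_disjoint_Ico_queue he x hij).mono Set.inter_subset_left
        Set.inter_subset_left
    · exact fun _ => measurableSet_Ico.inter hVm
    · exact fun i => measure_ne_top_of_subset Set.inter_subset_left (by simp)
  rw [hU, volume_real_iUnion_queue he x, hV, volume_real_iUnion_queue he y, ← hU, ← hV] at h2
  linarith

/-- A function with Lipschitz constant `D` that goes from `≥ e` to `≤ -e` spends enough time
near zero. -/
theorem sq_div_le_integral_of_crossing {z : ℝ → ℝ} {a b D e : ℝ} (hab : a ≤ b) (hD : 0 < D)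
    (he : 0 < e)
    (hz : ∀ s ∈ Set.Icc a b, ∀ t ∈ Set.Icc a b, |z s - z t| ≤ D * |s - t|)
    (ha : e ≤ z a) (hb : z b ≤ -e) :
    e ^ 2 / D ≤ ∫ t in a..b, max 0 (e - |z t|) := by
  have hlip : LipschitzOnWith ⟨D, hD.le⟩ z (Set.Icc a b) :=
    LipschitzOnWith.of_dist_le_mul fun s hs t ht => hz s hs t ht
  have hcont : ContinuousOn z (Set.Icc a b) := hlip.continuousOn
  obtain ⟨c, hc, hc0⟩ : ∃ c ∈ Set.Icc a b, z c = 0 :=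
    intermediate_value_Icc' hab hcont ⟨by linarith, by linarith⟩
  have hca : a + e / D ≤ c := by
    have h1 := hz a ⟨le_rfl, hab⟩ c hc
    rw [hc0, sub_zero, abs_of_nonneg (by linarith), abs_of_nonpos (by linarith [hc.1])] at h1
    have : e / D ≤ c - a := by rw [div_le_iff₀ hD]; linarith
    linarith
  have hcb : c + e / D ≤ b := by
    have h1 := hz b ⟨hab, le_rfl⟩ c hc
    rw [hc0, sub_zero, abs_of_nonpos (by linarith), abs_of_nonneg (by linarith [hc.2])] at h1
    have : e / D ≤ b - c := by rw [div_le_iff₀ hD]; linarith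
    linarith
  have hed : 0 < e / D := div_pos he hD
  have hcont' : ContinuousOn (fun t => max 0 (e - |z t|)) (Set.Icc a b) :=
    (continuous_const.max (continuous_const.sub continuous_abs)).comp_continuousOn hcont
  have hint : ∀ p q, a ≤ p → p ≤ q → q ≤ b →
      IntervalIntegrable (fun t => max 0 (e - |z t|)) volume p q := fun p q h1 h2 h3 =>
    (hcont'.mono (Set.Icc_subset_Icc h1 h3)).intervalIntegrable_of_Icc h2
  -- Around the zero `c` the integrand dominates a tent of height `e` and half-width `e / D`, whose
  -- area is `e ^ 2 / D`. The tent fits into `[a, b]` by the values at the ends.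
  have h1 : ∫ t in (c - e / D)..(c + e / D), max 0 (e - |z t|) ≤
      ∫ t in a..b, max 0 (e - |z t|) := by
    refine intervalIntegral.integral_mono_interval (by linarith) (by linarith) hcb ?_
      (hint a b le_rfl hab le_rfl)
    exact Filter.Eventually.of_forall fun t => le_max_left _ _
  refine le_trans ?_ h1
  rw [← intervalIntegral.integral_add_adjacent_intervals
    (hint (c - e / D) c (by linarith) (by linarith) (by linarith))
    (hint c (c + e / D) (by linarith) (by linarith) (by linarith))]
  have hl : ∫ t in (c - e / D)..c, (e - D * (c - t)) ≤
      ∫ t in (c - e / D)..c, max 0 (e - |z t|) := by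
    refine intervalIntegral.integral_mono_on (by linarith)
      (Continuous.intervalIntegrable (by fun_prop) _ _)
      (hint _ _ (by linarith) (by linarith) (by linarith)) fun t ht => ?_
    have := hz t ⟨by linarith [ht.1], by linarith [ht.2]⟩ c hc
    rw [hc0, sub_zero, abs_sub_comm, abs_of_nonneg (sub_nonneg.2 ht.2)] at this
    exact le_max_of_le_right (by linarith)
  have hr : ∫ t in c..(c + e / D), (e - D * (t - c)) ≤
      ∫ t in c..(c + e / D), max 0 (e - |z t|) := by
    refine intervalIntegral.integral_mono_on (by linarith)
      (Continuous.intervalIntegrable (by fun_prop) _ _)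
      (hint _ _ (by linarith) (by linarith) (by linarith)) fun t ht => ?_
    have := hz t ⟨by linarith [ht.1], by linarith [ht.2]⟩ c hc
    rw [hc0, sub_zero, abs_of_nonneg (sub_nonneg.2 ht.1)] at this
    exact le_max_of_le_right (by linarith)
  have vl : ∫ t in (c - e / D)..c, (e - D * (c - t)) = e ^ 2 / D / 2 := by
    rw [intervalIntegral.integral_sub (by simp) (Continuous.intervalIntegrable (by fun_prop) _ _),
      intervalIntegral.integral_const_mul, intervalIntegral.integral_sub (by simp) (by simp)]
    simp only [intervalIntegral.integral_const, integral_id, smul_eq_mul]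
    field_simp
    ring
  have vr : ∫ t in c..(c + e / D), (e - D * (t - c)) = e ^ 2 / D / 2 := by
    rw [intervalIntegral.integral_sub (by simp) (Continuous.intervalIntegrable (by fun_prop) _ _),
      intervalIntegral.integral_const_mul, intervalIntegral.integral_sub (by simp) (by simp)]
    simp only [intervalIntegral.integral_const, integral_id, smul_eq_mul]
    field_simp
    ring
  linarith

/-- Two families of `n` intervals of length `e`, moving past each other with relative speed at
most `D`, waste at least `(n e)² / D` through overlaps. -/
theorem sq_div_le_integral_waste {n : ℕ} {e D a b : ℝ} (he : 0 < e) (hD : 0 < D) (hab : a ≤ b)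
    {x y : ℝ → Fin n → ℝ} {W : ℝ → ℝ}
    (hlip : ∀ s ∈ Set.Icc a b, ∀ t ∈ Set.Icc a b, ∀ i j,
      |(x s i - y s j) - (x t i - y t j)| ≤ D * |s - t|)
    (ha : ∀ i j, y a j + n * e ≤ x a i) (hb : ∀ i j, x b i + n * e ≤ y b j)
    (hWi : IntervalIntegrable W volume a b)
    (hW : ∀ t ∈ Set.Icc a b, 2 * (n * e) - volume.real
      ((⋃ i, Set.Ico (x t i) (x t i + e)) ∪ ⋃ j, Set.Ico (y t j) (y t j + e)) ≤ W t) :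
    (n * e) ^ 2 / D ≤ ∫ t in a..b, W t := by
  -- The extremal `i` and `j` turn the bound on single pairs into uniform shifts of both families,
  -- which start times respect.
  have hone : ∀ s ∈ Set.Icc a b, ∀ t ∈ Set.Icc a b, ∀ k l,
      (queueStart e (x s) k - queueStart e (y s) l) -
        (queueStart e (x t) k - queueStart e (y t) l) ≤ D * |s - t| := by
    intro s hs t ht k l
    have : Nonempty (Fin n) := ⟨k⟩
    obtain ⟨i, hi⟩ := Finite.exists_max fun i => x s i - x t i
    obtain ⟨j, hj⟩ := Finite.exists_max fun j => y t j - y s j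
    have h1 := queueStart_le_add (e := e) (x := x s) (y := x t) (c := x s i - x t i)
      (fun i' => by linarith [hi i']) k
    have h2 := queueStart_le_add (e := e) (x := y t) (y := y s) (c := y t j - y s j)
      (fun j' => by linarith [hj j']) l
    have h3 := (abs_le.1 (hlip s hs t ht i j)).2
    linarith
  have hz : ∀ k l, ∀ s ∈ Set.Icc a b, ∀ t ∈ Set.Icc a b,
      |(queueStart e (x s) k - queueStart e (y s) l) -
        (queueStart e (x t) k - queueStart e (y t) l)| ≤ D * |s - t| := by
    intro k l s hs t ht
    refine abs_le.2 ⟨?_, hone s hs t ht k l⟩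
    have := hone t ht s hs k l
    rw [abs_sub_comm] at this
    linarith
  have hcont : ∀ k l, ContinuousOn
      (fun t => max 0 (e - |queueStart e (x t) k - queueStart e (y t) l|)) (Set.Icc a b) := by
    intro k l
    have : LipschitzOnWith ⟨D, hD.le⟩
        (fun t => queueStart e (x t) k - queueStart e (y t) l) (Set.Icc a b) :=
      LipschitzOnWith.of_dist_le_mul fun s hs t ht => hz k l s hs t ht
    exact (continuous_const.max (continuous_const.sub continuous_abs)).comp_continuousOn
      this.continuousOn
  have hint : ∀ k l, IntervalIntegrable
      (fun t => max 0 (e - |queueStart e (x t) k - queueStart e (y t) l|)) volume a b :=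
    fun k l => (hcont k l).intervalIntegrable_of_Icc hab
  have hint' : ∀ k, IntervalIntegrable
      (fun t => ∑ l, max 0 (e - |queueStart e (x t) k - queueStart e (y t) l|)) volume a b :=
    fun k => (continuousOn_finsetSum _ fun l _ => hcont k l).intervalIntegrable_of_Icc hab
  calc (n * e) ^ 2 / D = ∑ _k : Fin n, ∑ _l : Fin n, e ^ 2 / D := by
        simp only [Finset.sum_const, Finset.card_univ, Fintype.card_fin, nsmul_eq_mul]; ring
    _ ≤ ∑ k, ∑ l, ∫ t in a..b,
          max 0 (e - |queueStart e (x t) k - queueStart e (y t) l|) := by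
        refine Finset.sum_le_sum fun k _ => Finset.sum_le_sum fun l _ => ?_
        -- The gap `n * e` lets one queue finish before the other starts, so every pair of jobs is
        -- in one order at `a` and in the other at `b`.
        refine sq_div_le_integral_of_crossing hab hD he (hz k l) ?_ ?_
        · have : Nonempty (Fin n) := ⟨k⟩
          obtain ⟨i, hi⟩ := Finite.exists_min (x a)
          have h1 := le_queueStart (e := e) (x a) hi k
          have h2 := queueStart_le he.le (y a) (c := x a i - n * e)
            (fun j => by linarith [ha i j]) l
          linarith
        · have : Nonempty (Fin n) := ⟨k⟩
          obtain ⟨j, hj⟩ := Finite.exists_min (y b)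
          have h1 := le_queueStart (e := e) (y b) hj l
          have h2 := queueStart_le he.le (x b) (c := y b j - n * e)
            (fun i => by linarith [hb i j]) k
          linarith
    _ = ∫ t in a..b, ∑ k, ∑ l,
          max 0 (e - |queueStart e (x t) k - queueStart e (y t) l|) := by
        rw [intervalIntegral.integral_finsetSum fun k _ => hint' k]
        exact Finset.sum_congr rfl fun k _ =>
          (intervalIntegral.integral_finsetSum fun l _ => hint k l).symm
    _ ≤ ∫ t in a..b, W t := by
        refine intervalIntegral.integral_mono_on hab
          ((continuousOn_finsetSum _ fun k _ => continuousOn_finsetSum _ fun l _ =>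
            hcont k l).intervalIntegrable_of_Icc hab) hWi fun t ht => ?_
        have := volume_union_add_sum_le he (x t) (y t)
        linarith [hW t ht]

/-! ### Integrals of |cos| over short windows -/

theorem periodic_abs_cos_sub (p : ℝ) : Function.Periodic (fun θ => |Real.cos (p - θ)|) Real.pi := by
  intro θ
  simp only
  rw [← sub_sub, Real.cos_sub_pi, abs_neg]

theorem continuous_abs_cos_sub (p : ℝ) : Continuous fun θ => |Real.cos (p - θ)| := by fun_prop

theorem integral_cos_sub_left (p a b : ℝ) :
    ∫ θ in a..b, Real.cos (p - θ) = Real.sin (p - a) - Real.sin (p - b) := by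
  rw [intervalIntegral.integral_comp_sub_left (fun θ => Real.cos θ), integral_cos]

theorem integral_abs_cos_sub (p v : ℝ) : ∫ θ in v..(v + Real.pi), |Real.cos (p - θ)| = 2 := by
  rw [(periodic_abs_cos_sub p).intervalIntegral_add_eq v (p - Real.pi / 2)]
  have h : ∫ θ in (p - Real.pi / 2)..(p - Real.pi / 2 + Real.pi), |Real.cos (p - θ)| =
      ∫ θ in (p - Real.pi / 2)..(p - Real.pi / 2 + Real.pi), Real.cos (p - θ) := by
    refine intervalIntegral.integral_congr fun θ hθ => ?_
    rw [Set.uIcc_of_le (by linarith [Real.pi_pos])] at hθ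
    exact abs_of_nonneg (Real.cos_nonneg_of_mem_Icc ⟨by linarith [hθ.2], by linarith [hθ.1]⟩)
  rw [h, integral_cos_sub_left]
  have h1 : p - (p - Real.pi / 2) = Real.pi / 2 := by ring
  have h2 : p - (p - Real.pi / 2 + Real.pi) = -(Real.pi / 2) := by ring
  rw [h1, h2, Real.sin_neg, Real.sin_pi_div_two]
  norm_num

theorem abs_sin_sub_sin_le_integral {p q : ℝ} (hpq : p ≤ q) :
    |Real.sin q - Real.sin p| ≤ ∫ θ in p..q, |Real.cos θ| := by
  rw [← integral_cos]
  exact intervalIntegral.abs_integral_le_integral_abs hpq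

/-- Among windows of length `2 * a`, the one centred at a zero of the cosine has the least integral,
namely the left side. -/
theorem two_sub_two_cos_le_integral {v a : ℝ} (ha0 : 0 ≤ a) (ha : a ≤ Real.pi / 2)
    (hv0 : 0 ≤ v) (hv : v ≤ Real.pi) :
    2 - 2 * Real.cos a ≤ ∫ θ in (v - a)..(v + a), |Real.cos θ| := by
  have hca : 0 ≤ Real.cos a := Real.cos_nonneg_of_mem_Icc ⟨by linarith, ha⟩
  have hca1 := Real.cos_le_one a
  have hsa : 0 ≤ Real.sin a := Real.sin_nonneg_of_nonneg_of_le_pi ha0 (by linarith)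
  have hsc := Real.sin_sq_add_cos_sq a
  by_cases hin : |v - Real.pi / 2| ≤ a
  -- The window contains the zero π/2; splitting there gives 2 - 2 sin v cos a.
  · have hin' := abs_le.1 hin
    have hi : ∀ p q, IntervalIntegrable (fun θ => |Real.cos θ|) volume p q := fun p q =>
      Continuous.intervalIntegrable (by fun_prop) _ _
    rw [← intervalIntegral.integral_add_adjacent_intervals (hi (v - a) (Real.pi / 2)) (hi _ _)]
    have h1 := abs_sin_sub_sin_le_integral (p := v - a) (q := Real.pi / 2) (by linarith)
    have h2 := abs_sin_sub_sin_le_integral (p := Real.pi / 2) (q := v + a) (by linarith)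
    rw [Real.sin_pi_div_two] at h1 h2
    have h3 := (le_abs_self _).trans h1
    have h4 := (neg_le_abs _).trans h2
    rw [Real.sin_sub] at h3
    rw [Real.sin_add] at h4
    have := mul_le_mul_of_nonneg_right (Real.sin_le_one v) hca
    linarith
  · push Not at hin
    have h := abs_sin_sub_sin_le_integral (p := v - a) (q := v + a) (by linarith)
    have e1 : Real.sin (v + a) - Real.sin (v - a) = 2 * Real.cos v * Real.sin a := by
      rw [Real.sin_add, Real.sin_sub]; ring
    rw [e1, abs_mul, abs_mul, abs_of_nonneg hsa, abs_two] at h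
    -- Away from the zero, the bound becomes 2 sin² a = 2(1 - cos a)(1 + cos a), which is enough.
    have hc : Real.sin a ≤ |Real.cos v| := by
      rcases lt_abs.1 hin with h1 | h1
      · have : Real.cos v = - Real.sin (v - Real.pi / 2) := by
          rw [Real.sin_sub_pi_div_two, neg_neg]
        rw [this, abs_neg]
        exact (Real.sin_le_sin_of_le_of_le_pi_div_two (by linarith) (by linarith) h1.le).trans
          (le_abs_self _)
      · have : Real.cos v = Real.sin (Real.pi / 2 - v) := by rw [Real.sin_pi_div_two_sub]
        rw [this]
        exact (Real.sin_le_sin_of_le_of_le_pi_div_two (by linarith) (by linarith)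
          (by linarith)).trans (le_abs_self _)
    nlinarith

theorem two_sub_two_cos_le_integral_sub {a : ℝ} (ha0 : 0 ≤ a) (ha : a ≤ Real.pi / 2) (p v : ℝ) :
    2 - 2 * Real.cos a ≤ ∫ θ in (v - a)..(v + a), |Real.cos (p - θ)| := by
  rw [intervalIntegral.integral_comp_sub_left (fun θ => |Real.cos θ|)]
  obtain ⟨n, hn, -⟩ := existsUnique_add_zsmul_mem_Ico Real.pi_pos (p - v) 0
  rw [zero_add, zsmul_eq_mul] at hn
  have h := two_sub_two_cos_le_integral ha0 ha hn.1 hn.2.le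
  have hper : ∀ x : ℝ, |Real.cos (x + n * Real.pi)| = |Real.cos x| := by
    intro x
    rw [Real.cos_add_int_mul_pi, abs_mul]
    rcases Int.even_or_odd n with hn | hn
    · simp [hn.neg_one_zpow]
    · simp [hn.neg_one_zpow]
  have h2 := intervalIntegral.integral_comp_add_right (a := p - (v + a)) (b := p - (v - a))
    (fun θ => |Real.cos θ|) (n * Real.pi)
  simp only [hper] at h2
  rw [h2]
  convert h using 2 <;> ring

/-! ### Covers of an interval -/

/-- The set `G` enters as a whole, so overlaps inside it are not counted twice; this is how overlaps
become waste. -/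
theorem sub_le_volume_add_sum {ι : Type*} {G : Set ℝ} (hG : volume G ≠ ⊤) (T : Finset ι)
    (J : ι → Set ℝ) (hJ : ∀ i ∈ T, volume (J i) ≠ ⊤) {a b : ℝ}
    (hcov : ∀ s ∈ Set.Icc a b, s ∈ G ∨ ∃ i ∈ T, s ∈ J i) :
    b - a ≤ volume.real G + ∑ i ∈ T, volume.real (J i) := by
  have hsub : Set.Icc a b ⊆ G ∪ ⋃ i ∈ T, J i := by
    intro s hs
    rcases hcov s hs with h | ⟨i, hi, h⟩
    · exact Or.inl h
    · exact Or.inr (Set.mem_biUnion hi h)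
  have hfin : volume (⋃ i ∈ T, J i) ≠ ⊤ :=
    ((measure_biUnion_finset_le _ _).trans_lt (ENNReal.sum_lt_top.2 fun i hi =>
      (hJ i hi).lt_top)).ne
  calc b - a ≤ volume.real (Set.Icc a b) := by
        rw [Real.volume_real_Icc]; exact le_max_left _ _
    _ ≤ volume.real (G ∪ ⋃ i ∈ T, J i) :=
        measureReal_mono hsub (measure_union_ne_top hG hfin)
    _ ≤ volume.real G + volume.real (⋃ i ∈ T, J i) := measureReal_union_le _ _
    _ ≤ volume.real G + ∑ i ∈ T, volume.real (J i) := by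
        gcongr; exact measureReal_biUnion_finset_le _ _

theorem volume_real_closedBall {q r : ℝ} (hr : 0 ≤ r) :
    volume.real (Metric.closedBall q r) = 2 * r := by
  rw [measureReal_def, Real.volume_closedBall, ENNReal.toReal_ofReal (by linarith)]

theorem sub_le_sum_of_cover {ι : Type*} (T : Finset ι)
    (q r : ι → ℝ) (hr : ∀ i ∈ T, 0 ≤ r i) {a b : ℝ}
    (hcov : ∀ s ∈ Set.Icc a b, ∃ i ∈ T, |s - q i| ≤ r i) :
    b - a ≤ ∑ i ∈ T, 2 * r i := by
  have := sub_le_volume_add_sum (G := ∅) (by simp) T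
    (fun i => Metric.closedBall (q i) (r i)) (fun i _ => measure_closedBall_lt_top.ne) (a := a)
    (b := b) fun s hs => Or.inr (by simpa [Real.dist_eq] using hcov s hs)
  rw [measureReal_empty, zero_add] at this
  exact this.trans (Finset.sum_le_sum fun i hi => (volume_real_closedBall (hr i hi)).le)

/-! ### The waste of a covering family and its two elementary consequences -/

/-- Segments of length `e` with centres `(x i, y i)` and directions `(cos (ψ i), sin (ψ i))`
meet every line that meets the unit disc. -/
def CoversDisc {ι : Type*} (e : ℝ) (x y ψ : ι → ℝ) : Prop :=
  ∀ θ, ∀ s ∈ Set.Icc (-1 : ℝ) 1, ∃ i,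
    |s - (x i * Real.cos θ + y i * Real.sin θ)| ≤ e / 2 * |Real.cos (ψ i - θ)|

/-- The excess of the total length of the projections over the width of the unit disc. -/
noncomputable def waste {ι : Type*} [Fintype ι] (e : ℝ) (ψ : ι → ℝ) (θ : ℝ) : ℝ :=
  e * ∑ i, |Real.cos (ψ i - θ)| - 2

theorem continuous_waste {ι : Type*} [Fintype ι] (e : ℝ) (ψ : ι → ℝ) :
    Continuous (waste e ψ) := by
  unfold waste; fun_prop

/-- Cauchy–Crofton: each segment has mean shadow independent of its direction, while the disc has
width 2 everywhere. -/
theorem integral_waste {ι : Type*} [Fintype ι] (e : ℝ) (ψ : ι → ℝ) (v : ℝ) :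
    ∫ θ in v..(v + Real.pi), waste e ψ θ = 2 * (e * Fintype.card ι - Real.pi) := by
  unfold waste
  rw [intervalIntegral.integral_sub (Continuous.intervalIntegrable (by fun_prop) _ _) (by simp),
    intervalIntegral.integral_const_mul, intervalIntegral.integral_finsetSum
      fun i _ => (continuous_abs_cos_sub _).intervalIntegrable _ _]
  simp only [integral_abs_cos_sub]
  simp
  ring

theorem CoversDisc.waste_nonneg {ι : Type*} [Fintype ι] {e : ℝ} {x y ψ : ι → ℝ} (he : 0 < e)
    (h : CoversDisc e x y ψ) (θ : ℝ) : 0 ≤ waste e ψ θ := by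
  have := sub_le_sum_of_cover Finset.univ
    (fun i => x i * Real.cos θ + y i * Real.sin θ) (fun i => e / 2 * |Real.cos (ψ i - θ)|)
    (fun i _ => by positivity) (a := -1) (b := 1)
    (fun s hs => by simpa using h θ s hs)
  rw [← Finset.mul_sum, ← Finset.mul_sum] at this
  unfold waste
  linarith

/-- Integrals of the waste over short intervals are bounded by the excess of total length. -/
theorem CoversDisc.integral_waste_le {ι : Type*} [Fintype ι] {e : ℝ} {x y ψ : ι → ℝ} (he : 0 < e)
    (h : CoversDisc e x y ψ) {a b : ℝ} (hab : a ≤ b) (hba : b ≤ a + Real.pi) :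
    ∫ θ in a..b, waste e ψ θ ≤ 2 * (e * Fintype.card ι - Real.pi) := by
  rw [← integral_waste e ψ a]
  exact intervalIntegral.integral_mono_interval le_rfl hab hba
    (Filter.Eventually.of_forall fun θ => h.waste_nonneg he θ)
    ((continuous_waste e ψ).intervalIntegrable _ _)

/-- Segments far from the disc are wasteful. -/
theorem CoversDisc.card_outside_le {ι : Type*} [Fintype ι] {e R : ℝ} {x y ψ : ι → ℝ} (he : 0 < e)
    (h : CoversDisc e x y ψ) (hR : 1 + e < R) (T : Finset ι)
    (hT : ∀ i ∈ T, R ^ 2 < x i ^ 2 + y i ^ 2) :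
    e * T.card * (1 - (1 + e) / R) ≤ e * Fintype.card ι - Real.pi := by
  classical
  have hR0 : 0 < R := by linarith
  set κ := (1 + e) / R with hκ
  have hκ0 : 0 ≤ κ := by positivity
  have hκ1 : κ ≤ 1 := by rw [hκ, div_le_one hR0]; exact hR.le
  -- `β` is the polar angle of the centre. For θ this close to it the centre projects beyond `1 +
  -- e`, so the whole shadow misses `[-1, 1]`.
  have hpol : ∀ i, ∃ β, i ∈ T → ∀ θ, κ ≤ |Real.cos (β - θ)| →
      1 + e < |x i * Real.cos θ + y i * Real.sin θ| := by
    intro i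
    refine ⟨Complex.arg ⟨x i, y i⟩, fun hi θ hθ => ?_⟩
    set z : ℂ := ⟨x i, y i⟩ with hz
    have hn : ‖z‖ ^ 2 = x i ^ 2 + y i ^ 2 := by
      rw [← Complex.normSq_eq_norm_sq, Complex.normSq_apply, hz]; ring
    have hRn : R < ‖z‖ := lt_of_pow_lt_pow_left₀ 2 (norm_nonneg _) (by rw [hn]; exact hT i hi)
    have hx : x i = ‖z‖ * Real.cos z.arg := (Complex.norm_mul_cos_arg z).symm
    have hy : y i = ‖z‖ * Real.sin z.arg := (Complex.norm_mul_sin_arg z).symm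
    have hq : x i * Real.cos θ + y i * Real.sin θ = ‖z‖ * Real.cos (z.arg - θ) := by
      rw [Real.cos_sub]
      conv_lhs => rw [hx, hy]
      ring
    rw [hq, abs_mul, abs_norm]
    have hRκ : 1 + e = R * κ := by rw [hκ]; field_simp
    rw [hRκ]
    have hκp : 0 < κ := by positivity
    calc R * κ < ‖z‖ * κ := by gcongr
      _ ≤ _ := by gcongr
  choose β hβ using hpol
  set f : ι → ℝ → ℝ := fun i => Set.indicator {θ | κ ≤ |Real.cos (β i - θ)|}
    (fun θ => |Real.cos (ψ i - θ)|) with hf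
  have hS : ∀ i, MeasurableSet {θ | κ ≤ |Real.cos (β i - θ)|} := fun i =>
    (isClosed_le continuous_const (continuous_abs_cos_sub _)).measurableSet
  have hfi : ∀ i a b, IntervalIntegrable (f i) volume a b := by
    intro i a b
    have := (continuous_abs_cos_sub (ψ i)).intervalIntegrable (μ := volume) a b
    rw [intervalIntegrable_iff] at this ⊢
    exact this.indicator (hS i)
  have hfper : ∀ i, Function.Periodic (f i) Real.pi := by
    intro i θ
    have h1 := periodic_abs_cos_sub (β i) θ
    have h2 := periodic_abs_cos_sub (ψ i) θ
    simp only at h1 h2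
    simp only [hf, Set.indicator, Set.mem_ofPred_eq, h1, h2]
  have hfint : ∀ i, 2 - 2 * κ ≤ ∫ θ in (0 : ℝ)..(0 + Real.pi), f i θ := by
    intro i
    rw [(hfper i).intervalIntegral_add_eq 0 (β i - Real.pi / 2)]
    set a := Real.arccos κ with ha
    have ha0 : 0 ≤ a := Real.arccos_nonneg _
    have ha1 : a ≤ Real.pi / 2 := Real.arccos_le_pi_div_two.2 hκ0
    have hcos : Real.cos a = κ := Real.cos_arccos (by linarith) hκ1
    have h1 := two_sub_two_cos_le_integral_sub ha0 ha1 (ψ i) (β i)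
    rw [hcos] at h1
    have h2 : ∫ θ in (β i - a)..(β i + a), |Real.cos (ψ i - θ)| =
        ∫ θ in (β i - a)..(β i + a), f i θ := by
      refine intervalIntegral.integral_congr fun θ hθ => ?_
      rw [Set.uIcc_of_le (by linarith)] at hθ
      have hmem : κ ≤ |Real.cos (β i - θ)| := by
        rw [← hcos, ← Real.cos_abs (β i - θ)]
        refine le_trans ?_ (le_abs_self _)
        exact Real.cos_le_cos_of_nonneg_of_le_pi (abs_nonneg _) (by linarith)
          (abs_le.2 ⟨by linarith [hθ.2], by linarith [hθ.1]⟩)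
      exact (Set.indicator_of_mem (s := {θ | κ ≤ |Real.cos (β i - θ)|}) hmem
        (fun θ => |Real.cos (ψ i - θ)|)).symm
    rw [h2] at h1
    refine h1.trans (intervalIntegral.integral_mono_interval (by linarith) (by linarith)
      (by linarith) ?_ (hfi _ _ _))
    refine Filter.Eventually.of_forall fun θ => ?_
    simp only [hf]
    exact Set.indicator_nonneg (fun _ _ => abs_nonneg _) θ
  -- The segments of `T` whose shadow misses `[-1, 1]` can be deleted without harming the cover at
  -- θ, so their shadows are pure waste.
  have hpt : ∀ θ, e * ∑ i ∈ T, f i θ ≤ waste e ψ θ := by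
    intro θ
    set T' := T.filter fun i => κ ≤ |Real.cos (β i - θ)| with hT'
    have h1 := sub_le_sum_of_cover (Finset.univ \ T')
      (fun i => x i * Real.cos θ + y i * Real.sin θ) (fun i => e / 2 * |Real.cos (ψ i - θ)|)
      (fun i _ => by positivity) (a := -1) (b := 1) (fun s hs => by
        obtain ⟨i, hi⟩ := h θ s hs
        refine ⟨i, ?_, hi⟩
        simp only [Finset.mem_sdiff, Finset.mem_univ, true_and, hT', Finset.mem_filter, not_and]
        intro hiT hκi
        have h2 := hβ i hiT θ hκi
        have h3 : |s| ≤ 1 := abs_le.2 hs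
        have h4 := abs_sub_abs_le_abs_sub (x i * Real.cos θ + y i * Real.sin θ) s
        rw [abs_sub_comm] at h4
        have h5 : e / 2 * |Real.cos (ψ i - θ)| ≤ e / 2 * 1 := by
          gcongr; exact Real.abs_cos_le_one _
        linarith)
    have h2 : ∑ i ∈ T, f i θ = ∑ i ∈ T', |Real.cos (ψ i - θ)| := by
      rw [hT', Finset.sum_filter]
      rfl
    have h3 := Finset.sum_sdiff (f := fun i => |Real.cos (ψ i - θ)|) (Finset.subset_univ T')
    rw [← Finset.mul_sum, ← Finset.mul_sum] at h1
    rw [h2]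
    unfold waste
    rw [← h3]
    linarith
  have hIi : IntervalIntegrable (fun θ => e * ∑ i ∈ T, f i θ) volume 0 (0 + Real.pi) := by
    refine IntervalIntegrable.const_mul ?_ e
    have := IntervalIntegrable.sum T fun i _ => hfi i 0 (0 + Real.pi)
    rwa [show (∑ i ∈ T, f i) = fun θ => ∑ i ∈ T, f i θ from
      funext fun θ => Finset.sum_apply θ T f] at this
  have hI := intervalIntegral.integral_mono_on (by linarith [Real.pi_pos]) hIi
    ((continuous_waste e ψ).intervalIntegrable _ _) (fun θ _ => hpt θ)
  rw [integral_waste, intervalIntegral.integral_const_mul,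
    intervalIntegral.integral_finsetSum fun i _ => hfi i _ _] at hI
  have h1 : ∑ _i ∈ T, (2 - 2 * κ) ≤ ∑ i ∈ T, ∫ θ in (0 : ℝ)..(0 + Real.pi), f i θ :=
    Finset.sum_le_sum fun i _ => hfint i
  rw [Finset.sum_const, nsmul_eq_mul] at h1
  have := mul_le_mul_of_nonneg_left h1 he.le
  linarith

/-- Every cap of the disc contains many centres. -/
theorem CoversDisc.le_card_cap {ι : Type*} [Fintype ι] {e t : ℝ} {x y ψ : ι → ℝ} (he : 0 < e)
    (h : CoversDisc e x y ψ) (ht : 0 ≤ t) (α : ℝ) (T : Finset ι)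
    (hT : ∀ i, t ≤ x i * Real.cos α + y i * Real.sin α → i ∈ T) :
    1 - t - e ≤ e * T.card := by
  -- Starting at `t + e / 2` ensures that any segment reaching the interval has its centre at height
  -- at least `t`.
  have := sub_le_sum_of_cover T
    (fun i => x i * Real.cos α + y i * Real.sin α) (fun i => e / 2)
    (fun i _ => by positivity) (a := t + e / 2) (b := 1) (fun s hs => by
      obtain ⟨i, hi⟩ := h α s ⟨by linarith [hs.1], hs.2⟩
      have h5 : e / 2 * |Real.cos (ψ i - α)| ≤ e / 2 * 1 := by
        gcongr; exact Real.abs_cos_le_one _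
      have hi' : |s - (x i * Real.cos α + y i * Real.sin α)| ≤ e / 2 := by linarith
      exact ⟨i, hT i (by linarith [(abs_le.1 hi').2, hs.1]), hi'⟩)
  rw [Finset.sum_const, nsmul_eq_mul] at this
  linarith

/-! ### Replacing a straight barrier by short segments of equal length -/

/-- A point `c` of `t` splits the complement of `t` into a left and a right part, both
order-connected. -/
theorem isSetSemiring_ordConnected : IsSetSemiring {s : Set ℝ | s.OrdConnected} where
  empty_mem := Set.ordConnected_empty
  inter_mem := fun s hs t ht => Set.OrdConnected.inter hs ht
  sdiff_eq_sUnion' := by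
    classical
    intro s hs t ht
    have hs' : s.OrdConnected := hs
    have ht' : t.OrdConnected := ht
    rcases t.eq_empty_or_nonempty with rfl | ⟨c, hc⟩
    · exact ⟨{s}, by simpa using hs, by simp, by simp⟩
    refine ⟨{s ∩ {x | x ∉ t ∧ x < c}, s ∩ {x | x ∉ t ∧ c < x}}, ?_, ?_, ?_⟩
    · have h1 : ({x | x ∉ t ∧ x < c} : Set ℝ).OrdConnected := by
        refine ⟨fun a ha b hb z hz => ⟨fun hzt => ?_, hz.2.trans_lt hb.2⟩⟩
        exact hb.1 (ht'.out hzt hc ⟨hz.2, hb.2.le⟩)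
      have h2 : ({x | x ∉ t ∧ c < x} : Set ℝ).OrdConnected := by
        refine ⟨fun a ha b hb z hz => ⟨fun hzt => ?_, ha.2.trans_le hz.1⟩⟩
        exact ha.1 (ht'.out hc hzt ⟨ha.2.le, hz.1⟩)
      intro u hu
      simp only [Finset.coe_insert, Finset.coe_singleton, Set.mem_insert_iff,
        Set.mem_singleton_iff] at hu
      rcases hu with rfl | rfl
      · exact hs'.inter h1
      · exact hs'.inter h2
    · have hd : Disjoint (s ∩ {x | x ∉ t ∧ x < c}) (s ∩ {x | x ∉ t ∧ c < x}) := by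
        refine Set.disjoint_left.2 fun x hx hx' => ?_
        exact absurd hx.2.2 (not_lt.2 hx'.2.2.le)
      intro u hu v hv huv
      simp only [Finset.coe_insert, Finset.coe_singleton, Set.mem_insert_iff,
        Set.mem_singleton_iff] at hu hv
      rcases hu with rfl | rfl <;> rcases hv with rfl | rfl
      · exact absurd rfl huv
      · exact hd
      · exact hd.symm
      · exact absurd rfl huv
    · ext x
      simp only [Set.mem_sdiff, Finset.coe_insert, Finset.coe_singleton, Set.sUnion_insert,
        Set.sUnion_singleton, Set.mem_union, Set.mem_inter_iff, Set.mem_ofPred_eq]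
      constructor
      · rintro ⟨h1, h2⟩
        rcases lt_trichotomy x c with h | h | h
        · exact Or.inl ⟨h1, h2, h⟩
        · exact absurd (h ▸ hc) h2
        · exact Or.inr ⟨h1, h2, h⟩
      · rintro (⟨h1, h2, -⟩ | ⟨h1, h2, -⟩) <;> exact ⟨h1, h2⟩

/-- A difference of a compact interval and finitely many intervals can be covered by finitely
many compact intervals of the same total length. -/
theorem exists_cover_Icc_diff {ι : Type*} (S : Finset ι) (I : ι → Set ℝ)
    (hI : ∀ i ∈ S, (I i).OrdConnected) (l : ℝ) :
    ∃ F : Finset (Set ℝ), ∃ a b : Set ℝ → ℝ, (∀ J ∈ F, a J ≤ b J) ∧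
      Set.Icc 0 l \ (⋃ i ∈ S, I i) ⊆ ⋃ J ∈ F, Set.Icc (a J) (b J) ∧
      ∑ J ∈ F, (b J - a J) ≤ volume.real (Set.Icc 0 l \ (⋃ i ∈ S, I i)) := by
  classical
  obtain ⟨F, hF1, hF2, hF3⟩ := isSetSemiring_ordConnected.exists_disjoint_finset_sdiff_eq
    (s := Set.Icc 0 l) (I := S.image I) Set.ordConnected_Icc (by
      intro u hu
      simp only [Finset.coe_image, Set.mem_image, Finset.mem_coe] at hu
      obtain ⟨i, hi, rfl⟩ := hu
      exact hI i hi)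
  have hU : (⋃₀ (↑(S.image I) : Set (Set ℝ))) = ⋃ i ∈ S, I i := by
    simp [Set.sUnion_image]
  rw [hU] at hF3
  refine ⟨F.filter fun J => J.Nonempty, sInf, sSup, ?_, ?_, ?_⟩
  all_goals
    have hsub : ∀ J ∈ F, J ⊆ Set.Icc 0 l := fun J hJ => by
      have : J ⊆ Set.Icc 0 l \ (⋃ i ∈ S, I i) := by
        rw [hF3]; exact Set.subset_sUnion_of_mem hJ
      exact this.trans Set.sdiff_subset
    have hbb : ∀ J ∈ F, BddBelow J := fun J hJ => bddBelow_Icc.mono (hsub J hJ)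
    have hba : ∀ J ∈ F, BddAbove J := fun J hJ => bddAbove_Icc.mono (hsub J hJ)
  · intro J hJ
    rw [Finset.mem_filter] at hJ
    exact Real.sInf_le_sSup J (hbb J hJ.1) (hba J hJ.1)
  · rw [hF3]
    intro x hx
    obtain ⟨J, hJ, hxJ⟩ := hx
    refine Set.mem_biUnion (x := J) (by simpa using ⟨hJ, ⟨x, hxJ⟩⟩) ?_
    exact ⟨csInf_le (hbb J hJ) hxJ, le_csSup (hba J hJ) hxJ⟩
  · rw [hF3, Set.sUnion_eq_biUnion]
    have h1 := measureReal_biUnion_finset (μ := volume) (s := F) (f := id) hF2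
      (fun J hJ => (hF1 hJ : J.OrdConnected).measurableSet)
      (fun J hJ => measure_ne_top_of_subset (hsub J hJ) (by simp))
    simp only [id] at h1
    rw [show (⋃ i ∈ (F : Set (Set ℝ)), i) = ⋃ b ∈ F, b from by simp, h1]
    refine (Finset.sum_le_sum fun J hJ => ?_).trans
      (Finset.sum_le_sum_of_subset_of_nonneg (Finset.filter_subset _ _)
        fun _ _ _ => measureReal_nonneg)
    rw [Finset.mem_filter] at hJ
    have hoc : J.OrdConnected := hF1 hJ.1
    have hsub2 : Set.Ioo (sInf J) (sSup J) ⊆ J := by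
      intro z hz
      obtain ⟨u, hu, huz⟩ := exists_lt_of_csInf_lt hJ.2 hz.1
      obtain ⟨v, hv, hzv⟩ := exists_lt_of_lt_csSup hJ.2 hz.2
      exact hoc.out hu hv ⟨huz.le, hzv.le⟩
    have := measureReal_mono (μ := volume) hsub2
      (measure_ne_top_of_subset (hsub J hJ.1) (by simp))
    rw [Real.volume_real_Ioo] at this
    exact (le_max_left _ _).trans this

/-- Every compact interval is covered by intervals of length `e` with little loss. -/
theorem exists_cover_Icc_of_length {a b e : ℝ} (hab : a ≤ b) (he : 0 < e) :
    ∃ n : ℕ, n * e ≤ b - a + e ∧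
      ∀ s ∈ Set.Icc a b, ∃ k : Fin n, |s - (a + (k : ℝ) * e + e / 2)| ≤ e / 2 := by
  -- The extra piece covers the remainder, and the end point `b` too; it overshoots by at most `e`.
  refine ⟨⌊(b - a) / e⌋₊ + 1, ?_, ?_⟩
  · have : (⌊(b - a) / e⌋₊ : ℝ) * e ≤ b - a := by
      rw [← le_div_iff₀ he]
      exact Nat.floor_le (div_nonneg (by linarith) he.le)
    push_cast
    linarith
  · intro s hs
    have h0 : 0 ≤ (s - a) / e := div_nonneg (by linarith [hs.1]) he.le
    refine ⟨⟨⌊(s - a) / e⌋₊, Nat.lt_succ_of_le (Nat.floor_le_floor (by gcongr; exact hs.2))⟩, ?_⟩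
    have h1 : (⌊(s - a) / e⌋₊ : ℝ) * e ≤ s - a := by
      rw [← le_div_iff₀ he]; exact Nat.floor_le h0
    have h2 : s - a < ((⌊(s - a) / e⌋₊ : ℝ) + 1) * e := by
      rw [← div_lt_iff₀ he]; exact Nat.lt_floor_add_one _
    simp only
    exact abs_le.2 ⟨by linarith, by linarith⟩

/-- The line through `(x, y)` in direction `(cos ψ, sin ψ)`, parametrized by arc length. -/
noncomputable def lineAt (x y ψ u : ℝ) : Plane :=
  !₂[x + u * Real.cos ψ, y + u * Real.sin ψ]

theorem isometry_lineAt (x y ψ : ℝ) : Isometry (lineAt x y ψ) := by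
  refine Isometry.of_dist_eq fun u v => ?_
  rw [EuclideanSpace.dist_eq, Real.dist_eq, Fin.sum_univ_two, ← Real.sqrt_sq_eq_abs]
  congr 1
  simp only [lineAt, Real.dist_eq, sq_abs]
  simp only [Matrix.cons_val_zero, Matrix.cons_val_one]
  linear_combination (u - v) ^ 2 * Real.sin_sq_add_cos_sq ψ

theorem lineAt_eq_add_smul (x y ψ u : ℝ) :
    lineAt x y ψ u = lineAt x y ψ 0 + u • (!₂[Real.cos ψ, Real.sin ψ] : Plane) := by
  ext i
  fin_cases i <;> simp [lineAt]

theorem segment_eq_image_lineAt (p q : Plane) :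
    ∃ ψ l, 0 ≤ l ∧ segment ℝ p q = lineAt (p 0) (p 1) ψ '' Set.Icc 0 l := by
  set z : ℂ := ⟨q 0 - p 0, q 1 - p 1⟩ with hz
  have hx : q 0 - p 0 = ‖z‖ * Real.cos z.arg := (Complex.norm_mul_cos_arg z).symm
  have hy : q 1 - p 1 = ‖z‖ * Real.sin z.arg := (Complex.norm_mul_sin_arg z).symm
  refine ⟨z.arg, ‖z‖, norm_nonneg _, ?_⟩
  have key : ∀ θ : ℝ, p + θ • (q - p) = lineAt (p 0) (p 1) z.arg (θ * ‖z‖) := by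
    intro θ
    ext i
    fin_cases i
    · simp [lineAt, mul_assoc, ← hx]
    · simp [lineAt, mul_assoc, ← hy]
  rw [segment_eq_image']
  ext v
  constructor
  · rintro ⟨θ, hθ, rfl⟩
    exact ⟨θ * ‖z‖, ⟨mul_nonneg hθ.1 (norm_nonneg _),
      mul_le_of_le_one_left (norm_nonneg _) hθ.2⟩, (key θ).symm⟩
  · rintro ⟨u, hu, rfl⟩
    rcases (norm_nonneg z).eq_or_lt with h0 | h0
    · refine ⟨0, by simp, ?_⟩
      have : u = 0 := le_antisymm (by rw [h0]; exact hu.2) hu.1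
      simp only [key, this, zero_mul]
    · refine ⟨u / ‖z‖, ⟨div_nonneg hu.1 h0.le, (div_le_one h0).2 hu.2⟩, ?_⟩
      simp only [key, div_mul_cancel₀ u h0.ne']

theorem ordConnected_preimage_lineAt {C : Set Plane} (hC : Convex ℝ C) (x y ψ : ℝ) :
    (lineAt x y ψ ⁻¹' C).OrdConnected := by
  refine ⟨fun a ha b hb c hc => ?_⟩
  have hseg : c ∈ segment ℝ a b := by rwa [segment_eq_Icc (hc.1.trans hc.2)]
  obtain ⟨s, t, hs, ht, hst, rfl⟩ := hseg
  have : lineAt x y ψ (s • a + t • b) = s • lineAt x y ψ a + t • lineAt x y ψ b := by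
    rw [lineAt_eq_add_smul, lineAt_eq_add_smul x y ψ a, lineAt_eq_add_smul x y ψ b]
    have h1 : s = 1 - t := by linarith
    subst h1
    module
  rw [Set.mem_preimage, this]
  exact hC ha hb hs ht hst

theorem hausdorffMeasure_image_lineAt (x y ψ : ℝ) (E : Set ℝ) :
    μH[1] (lineAt x y ψ '' E) = volume E := by
  rw [(isometry_lineAt x y ψ).hausdorffMeasure_image (Or.inl zero_le_one), hausdorffMeasure_real]

theorem measurableSet_biUnion_segment (S : Finset (Plane × Plane)) :
    MeasurableSet (⋃ s ∈ S, segment ℝ s.1 s.2) := by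
  refine Finset.measurableSet_biUnion _ fun s _ => ?_
  obtain ⟨ψ, l, -, h⟩ := segment_eq_image_lineAt s.1 s.2
  rw [h]
  exact (isCompact_Icc.image (isometry_lineAt _ _ _).continuous).measurableSet

/-- A straight set can be covered by finitely many segments whose total length is the
length of the set. -/
theorem exists_cover_of_biUnion_segment (S : Finset (Plane × Plane)) :
    ∃ (ι : Type) (_ : Fintype ι) (x y ψ l : ι → ℝ), (∀ i, 0 ≤ l i) ∧
      (∀ p ∈ ⋃ s ∈ S, segment ℝ s.1 s.2, ∃ i, ∃ u ∈ Set.Icc 0 (l i),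
        p = lineAt (x i) (y i) (ψ i) u) ∧
      ∑ i, l i ≤ planeLength (⋃ s ∈ S, segment ℝ s.1 s.2) := by
  classical
  induction S using Finset.induction with
  | empty =>
    exact ⟨Empty, inferInstance, Empty.elim, Empty.elim, Empty.elim, Empty.elim, by simp, by simp,
      by simp [planeLength]⟩
  | insert s S hs ih =>
    obtain ⟨ι, _, x, y, ψ, l, hl, hcov, hsum⟩ := ih
    obtain ⟨ψ', l', hl', hseg⟩ := segment_eq_image_lineAt s.1 s.2
    set B := ⋃ s ∈ S, segment ℝ s.1 s.2 with hB
    set g := lineAt (s.1 0) (s.1 1) ψ' with hg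
    obtain ⟨F, a, b, hab, hFcov, hFsum⟩ := exists_cover_Icc_diff S
      (fun s => g ⁻¹' segment ℝ s.1 s.2)
      (fun s _ => ordConnected_preimage_lineAt (convex_segment _ _) _ _ _) l'
    have hpre : (⋃ s ∈ S, g ⁻¹' segment ℝ s.1 s.2) = g ⁻¹' B := by
      simp [hB, Set.preimage_iUnion]
    rw [hpre] at hFcov hFsum
    -- Only the part of the new segment outside the earlier ones is added, because Hausdorff measure
    -- counts overlaps once.
    have hins : (⋃ t ∈ insert s S, segment ℝ t.1 t.2) = g '' (Set.Icc 0 l' \ g ⁻¹' B) ∪ B := by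
      rw [Finset.set_biUnion_insert, hseg, ← Set.sdiff_union_self]
      congr 1
      ext p
      constructor
      · rintro ⟨⟨u, hu, rfl⟩, hp⟩
        exact ⟨u, ⟨hu, hp⟩, rfl⟩
      · rintro ⟨u, ⟨hu, hp⟩, rfl⟩
        exact ⟨⟨u, hu, rfl⟩, hp⟩
    refine ⟨ι ⊕ F, inferInstance,
      Sum.elim x fun J => g (a J) 0, Sum.elim y fun J => g (a J) 1,
      Sum.elim ψ fun _ => ψ', Sum.elim l fun J => b J - a J, ?_, ?_, ?_⟩
    · rintro (i | J)
      · exact hl i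
      · exact sub_nonneg.2 (hab J J.2)
    · rw [hins]
      rintro p (⟨u, hu, rfl⟩ | hp)
      · obtain ⟨J, hJ, huJ⟩ := Set.mem_iUnion₂.1 (hFcov hu)
        refine ⟨Sum.inr ⟨J, hJ⟩, u - a J, ⟨sub_nonneg.2 huJ.1, by simpa using huJ.2⟩, ?_⟩
        ext i
        fin_cases i <;> simp [hg, lineAt] <;> ring
      · obtain ⟨i, u, hu, rfl⟩ := hcov p hp
        exact ⟨Sum.inl i, u, hu, rfl⟩
    · have hBfin : μH[1] B ≠ ⊤ := IsStraight.length_ne_top ⟨S, hB⟩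
      have hd : Disjoint (g '' (Set.Icc 0 l' \ g ⁻¹' B)) B := by
        refine Set.disjoint_left.2 ?_
        rintro _ ⟨u, hu, rfl⟩ h
        exact hu.2 h
      have hfin : volume (Set.Icc 0 l' \ g ⁻¹' B) ≠ ⊤ :=
        measure_ne_top_of_subset Set.sdiff_subset (by simp)
      rw [hins, planeLength, measure_union hd (measurableSet_biUnion_segment S),
        hausdorffMeasure_image_lineAt, ENNReal.toReal_add hfin hBfin, Fintype.sum_sum_type]
      simp only [Sum.elim_inl, Sum.elim_inr]
      rw [add_comm]
      refine add_le_add ?_ hsum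
      rw [Finset.sum_coe_sort F (fun J => b J - a J)]
      exact hFsum

/-- A straight set can be covered by segments of a given small length `e` with total length
close to the length of the set. -/
theorem IsStraight.exists_cover_of_length {B : Set Plane} (hB : IsStraight B) :
    ∃ K : ℝ, 0 ≤ K ∧ ∀ e > 0, ∃ (ι : Type) (_ : Fintype ι) (x y ψ : ι → ℝ),
      e * Fintype.card ι ≤ planeLength B + K * e ∧
      ∀ p ∈ B, ∃ i, ∃ u, |u| ≤ e / 2 ∧ p = lineAt (x i) (y i) (ψ i) u := by
  obtain ⟨S, rfl⟩ := hB
  obtain ⟨ι, _, x, y, ψ, l, hl, hcov, hsum⟩ := exists_cover_of_biUnion_segment S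
  -- Each of the original pieces wastes at most one length `e` when it is cut up.
  refine ⟨Fintype.card ι, by positivity, fun e he => ?_⟩
  choose n hn hk using fun i => exists_cover_Icc_of_length (hl i) he
  refine ⟨Σ i, Fin (n i), inferInstance,
    fun j => lineAt (x j.1) (y j.1) (ψ j.1) (0 + (j.2 : ℝ) * e + e / 2) 0,
    fun j => lineAt (x j.1) (y j.1) (ψ j.1) (0 + (j.2 : ℝ) * e + e / 2) 1,
    fun j => ψ j.1, ?_, ?_⟩
  · rw [Fintype.card_sigma]
    simp only [Fintype.card_fin]
    push_cast
    have h1 : ∑ i, (n i : ℝ) * e ≤ ∑ i, (l i - 0 + e) := Finset.sum_le_sum fun i _ => hn i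
    rw [Finset.sum_add_distrib, ← Finset.sum_mul, Finset.sum_const, nsmul_eq_mul] at h1
    simp only [sub_zero, Finset.card_univ] at h1
    linarith
  · intro p hp
    obtain ⟨i, u, hu, rfl⟩ := hcov p hp
    obtain ⟨k, hk⟩ := hk i u hu
    refine ⟨⟨i, k⟩, _, hk, ?_⟩
    ext j
    fin_cases j <;> simp [lineAt] <;> ring

/-- Lines in normal form. -/
theorem IsBarrier.exists_mem_line {B : Set Plane} (hB : IsBarrier unitDisc B) (θ s : ℝ)
    (hs : s ∈ Set.Icc (-1 : ℝ) 1) : ∃ p ∈ B, p 0 * Real.cos θ + p 1 * Real.sin θ = s := by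
  set d : Plane := !₂[-Real.sin θ, Real.cos θ] with hd
  have hd0 : d ≠ 0 := by
    intro h
    have h0 : d 0 = 0 := by rw [h]; rfl
    have h1 : d 1 = 0 := by rw [h]; rfl
    simp [hd] at h0 h1
    have := Real.sin_sq_add_cos_sq θ
    rw [h0, h1] at this
    norm_num at this
  set c : Plane := !₂[s * Real.cos θ, s * Real.sin θ] with hc
  obtain ⟨p, hp, hpB⟩ := hB (AffineSubspace.mk' c (Submodule.span ℝ {d}))
    (by rw [IsLine, AffineSubspace.direction_mk', finrank_span_singleton hd0])
    ⟨c, AffineSubspace.self_mem_mk' _ _, by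
      rw [unitDisc, mem_closedBall_zero_iff, EuclideanSpace.norm_eq, Fin.sum_univ_two]
      refine Real.sqrt_le_iff.2 ⟨zero_le_one, ?_⟩
      simp only [hc, Matrix.cons_val_zero, Matrix.cons_val_one, Real.norm_eq_abs,
        sq_abs]
      have := Real.sin_sq_add_cos_sq θ
      have h2 : s ^ 2 ≤ 1 := by rw [sq_le_one_iff_abs_le_one]; exact abs_le.2 hs
      nlinarith⟩
  refine ⟨p, hpB, ?_⟩
  rw [SetLike.mem_coe, AffineSubspace.mem_mk', vsub_eq_sub, Submodule.mem_span_singleton] at hp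
  obtain ⟨a, ha⟩ := hp
  have hp' : p = a • d + c := by rw [ha]; abel
  rw [hp']
  simp [hd, hc]
  linear_combination s * Real.sin_sq_add_cos_sq θ

theorem IsStraightBarrier.exists_coversDisc {B : Set Plane} (hB : IsStraightBarrier unitDisc B) :
    ∃ K : ℝ, 0 ≤ K ∧ ∀ e > 0, ∃ (ι : Type) (_ : Fintype ι) (x y ψ : ι → ℝ),
      e * Fintype.card ι ≤ planeLength B + K * e ∧ CoversDisc e x y ψ := by
  obtain ⟨K, hK, h⟩ := hB.1.exists_cover_of_length
  refine ⟨K, hK, fun e he => ?_⟩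
  obtain ⟨ι, _, x, y, ψ, hlen, hcov⟩ := h e he
  refine ⟨ι, _, x, y, ψ, hlen, fun θ s hs => ?_⟩
  obtain ⟨p, hp, hps⟩ := hB.2.exists_mem_line θ s hs
  obtain ⟨i, u, hu, rfl⟩ := hcov p hp
  refine ⟨i, ?_⟩
  have : s - (x i * Real.cos θ + y i * Real.sin θ) = u * Real.cos (ψ i - θ) := by
    rw [← hps, Real.cos_sub]
    simp [lineAt]
    ring
  rw [this, abs_mul]
  gcongr

/-! ### Two families whose shadows cross -/

/-- Cauchy–Schwarz, and a chord of the unit circle is no longer than its arc. So shadows of points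
at distance at most `D` have relative speed at most `D`. -/
theorem abs_mul_cos_sub_add_le {u v D : ℝ} (hD : 0 ≤ D) (huv : u ^ 2 + v ^ 2 ≤ D ^ 2) (s t : ℝ) :
    |u * (Real.cos s - Real.cos t) + v * (Real.sin s - Real.sin t)| ≤ D * |s - t| := by
  have h1 : (Real.cos s - Real.cos t) ^ 2 + (Real.sin s - Real.sin t) ^ 2 ≤ (s - t) ^ 2 := by
    have := Real.one_sub_sq_div_two_le_cos (x := s - t)
    rw [Real.cos_sub] at this
    nlinarith [Real.sin_sq_add_cos_sq s, Real.sin_sq_add_cos_sq t]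
  refine abs_le_of_sq_le_sq ?_ (by positivity)
  rw [mul_pow, sq_abs]
  calc (u * (Real.cos s - Real.cos t) + v * (Real.sin s - Real.sin t)) ^ 2
      ≤ (u ^ 2 + v ^ 2) * ((Real.cos s - Real.cos t) ^ 2 + (Real.sin s - Real.sin t) ^ 2) := by
        nlinarith [sq_nonneg (u * (Real.sin s - Real.sin t) - v * (Real.cos s - Real.cos t))]
    _ ≤ D ^ 2 * (s - t) ^ 2 := by gcongr

/-- Two families of segments facing each other force the total length to be large. -/
theorem CoversDisc.facing_le {ι : Type*} [Fintype ι] {e : ℝ} {x y ψ : ι → ℝ}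
    (he : 0 < e) (h : CoversDisc e x y ψ) {θ₀ φ c D : ℝ} {n : ℕ} (hc : 0 < c) (hφ0 : 0 ≤ φ)
    (hφ : 2 * φ ≤ Real.pi) (hD : 0 < D) (P Q : Finset ι) (hP : P.card = n) (hQ : Q.card = n)
    (h1 : ∀ i ∈ P, ∀ j ∈ Q,
      x j * Real.cos (θ₀ - φ) + y j * Real.sin (θ₀ - φ) + n * (c * e) ≤
        x i * Real.cos (θ₀ - φ) + y i * Real.sin (θ₀ - φ))
    (h2 : ∀ i ∈ P, ∀ j ∈ Q,
      x i * Real.cos (θ₀ + φ) + y i * Real.sin (θ₀ + φ) + n * (c * e) ≤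
        x j * Real.cos (θ₀ + φ) + y j * Real.sin (θ₀ + φ))
    (hdist : ∀ i ∈ P, ∀ j ∈ Q, (x i - x j) ^ 2 + (y i - y j) ^ 2 ≤ D ^ 2)
    (hdirP : ∀ i ∈ P, ∀ θ, |θ - θ₀| ≤ φ → c ≤ |Real.cos (ψ i - θ)|)
    (hdirQ : ∀ i ∈ Q, ∀ θ, |θ - θ₀| ≤ φ → c ≤ |Real.cos (ψ i - θ)|) :
    (n * (c * e)) ^ 2 / D ≤ 2 * (e * Fintype.card ι - Real.pi) := by
  classical
  have hce : 0 < c * e := by positivity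
  have hPQ : Disjoint P Q := by
    refine Finset.disjoint_left.2 fun i hi hi' => ?_
    have hn : 0 < n := hP ▸ Finset.card_pos.2 ⟨i, hi⟩
    have hn' : (0 : ℝ) < n := by exact_mod_cast hn
    have := h1 i hi i hi'
    nlinarith [mul_pos hn' hce]
  let p := (P.equivFinOfCardEq hP).symm
  let q := (Q.equivFinOfCardEq hQ).symm
  set pr : ι → ℝ → ℝ := fun i θ => x i * Real.cos θ + y i * Real.sin θ with hpr
  refine le_trans ?_ (h.integral_waste_le he (a := θ₀ - φ) (b := θ₀ + φ) (by linarith)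
    (by linarith))
  -- The shadows have varying lengths; each is cut down to a concentric interval of the common
  -- length `c * e`, and the queue argument is applied to these.
  refine sq_div_le_integral_waste hce hD (by linarith)
    (x := fun θ i => pr (p i) θ - c * e / 2) (y := fun θ j => pr (q j) θ - c * e / 2) ?_ ?_ ?_
    ((continuous_waste e ψ).intervalIntegrable _ _) ?_
  · intro s _ t _ i j
    have := abs_mul_cos_sub_add_le hD.le (hdist (p i) (p i).2 (q j) (q j).2) s t
    convert this using 2
    simp only [hpr]
    ring
  · intro i j
    have := h1 (p i) (p i).2 (q j) (q j).2
    simp only [hpr]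
    linarith
  · intro i j
    have := h2 (p i) (p i).2 (q j) (q j).2
    simp only [hpr]
    linarith
  · intro θ hθ
    have hθ' : |θ - θ₀| ≤ φ := abs_le.2 ⟨by linarith [hθ.1], by linarith [hθ.2]⟩
    have hdir : ∀ i ∈ P ∪ Q, c ≤ |Real.cos (ψ i - θ)| := by
      intro i hi
      rcases Finset.mem_union.1 hi with hi | hi
      · exact hdirP i hi θ hθ'
      · exact hdirQ i hi θ hθ'
    set I : ι → Set ℝ := fun i => Set.Ico (pr i θ - c * e / 2) (pr i θ - c * e / 2 + c * e)
      with hI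
    have hfin : ∀ r : Fin n → ι, volume (⋃ k, I (r k)) ≠ ⊤ := fun r =>
      ((measure_iUnion_fintype_le _ _).trans_lt (ENNReal.sum_lt_top.2 fun i _ => by
        simp [hI])).ne
    have hsub : ∀ i ∈ P ∪ Q, I i ⊆ (⋃ k, I (p k)) ∪ ⋃ k, I (q k) := by
      intro i hi
      rcases Finset.mem_union.1 hi with hi | hi
      · refine Set.subset_union_of_subset_left ?_ _
        have : I i = I (p (p.symm ⟨i, hi⟩)) := by simp
        rw [this]
        exact Set.subset_iUnion (fun k => I (p k)) _
      · refine Set.subset_union_of_subset_right ?_ _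
        have : I i = I (q (q.symm ⟨i, hi⟩)) := by simp
        rw [this]
        exact Set.subset_iUnion (fun k => I (q k)) _
    have hIball : ∀ i ∈ P ∪ Q,
        I i ⊆ Metric.closedBall (pr i θ) (e / 2 * |Real.cos (ψ i - θ)|) := by
      intro i hi s hs
      have := mul_le_mul_of_nonneg_right (hdir i hi) he.le
      rw [Metric.mem_closedBall, Real.dist_eq]
      exact abs_le.2 ⟨by linarith [hs.1], by linarith [hs.2]⟩
    -- The cut-down intervals form `G`, and only the trimmings of the shadows are counted singly;
    -- hence the overlap within `G` is bounded by the waste.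
    have key := sub_le_volume_add_sum (G := (⋃ k, I (p k)) ∪ ⋃ k, I (q k))
      (measure_union_ne_top (hfin fun k => p k) (hfin fun k => q k)) Finset.univ
      (fun i => Metric.closedBall (pr i θ) (e / 2 * |Real.cos (ψ i - θ)|) \
        if i ∈ P ∪ Q then I i else ∅)
      (fun i _ => measure_ne_top_of_subset Set.sdiff_subset measure_closedBall_lt_top.ne)
      (a := -1) (b := 1) (fun s hs => by
        obtain ⟨i, hi⟩ := h θ s hs
        by_cases hmem : s ∈ if i ∈ P ∪ Q then I i else ∅
        · by_cases hiPQ : i ∈ P ∪ Q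
          · rw [if_pos hiPQ] at hmem
            exact Or.inl (hsub i hiPQ hmem)
          · rw [if_neg hiPQ] at hmem
            exact absurd hmem (Set.notMem_empty s)
        · exact Or.inr ⟨i, Finset.mem_univ i, by
            rw [Metric.mem_closedBall, Real.dist_eq]; exact hi, hmem⟩)
    have hvol : ∀ i, volume.real (Metric.closedBall (pr i θ) (e / 2 * |Real.cos (ψ i - θ)|) \
        if i ∈ P ∪ Q then I i else ∅) =
        e * |Real.cos (ψ i - θ)| - if i ∈ P ∪ Q then c * e else 0 := by
      intro i
      by_cases hi : i ∈ P ∪ Q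
      · rw [if_pos hi, if_pos hi, measureReal_sdiff (hIball i hi) measurableSet_Ico
          measure_closedBall_lt_top.ne,
          volume_real_closedBall (by positivity), hI, Real.volume_real_Ico_of_le (by linarith)]
        ring
      · rw [if_neg hi, if_neg hi, Set.sdiff_empty, volume_real_closedBall (by positivity)]
        ring
    simp only [hvol] at key
    rw [Finset.sum_sub_distrib, ← Finset.mul_sum, Finset.sum_ite_mem, Finset.univ_inter,
      Finset.sum_const, Finset.card_union_of_disjoint hPQ, hP, hQ, nsmul_eq_mul] at key
    push_cast at key
    simp only [waste]
    linarith

/-! ### Shadows of circular caps and the separating angle -/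

/-- When χ lies beyond the polar angle of the corner `(t, w)`, that corner maximizes the projection
over the cap. The tangent inequality tξ + wζ ≤ t² + w² at the corner proves it. -/
theorem cap_upper {ξ ζ t w χ : ℝ} (hw : 0 < w) (ht : t ≤ ξ) (h : ξ ^ 2 + ζ ^ 2 ≤ t ^ 2 + w ^ 2)
    (hs : 0 ≤ Real.sin χ) (hc : w * Real.cos χ ≤ t * Real.sin χ) :
    ξ * Real.cos χ + ζ * Real.sin χ ≤ t * Real.cos χ + w * Real.sin χ := by
  have h1 : w * ζ ≤ w ^ 2 - t * (ξ - t) := by nlinarith [sq_nonneg (ξ - t), sq_nonneg (ζ - w)]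
  have h2 := mul_le_mul_of_nonneg_right h1 hs
  have h3 := mul_le_mul_of_nonneg_left hc (sub_nonneg.2 ht)
  refine le_of_mul_le_mul_left ?_ hw
  linarith

theorem cap_abs_le {ξ ζ t w : ℝ} (hw : 0 ≤ w) (ht0 : 0 ≤ t) (ht : t ≤ ξ)
    (h : ξ ^ 2 + ζ ^ 2 ≤ t ^ 2 + w ^ 2) : |ζ| ≤ w :=
  abs_le_of_sq_le_sq (by nlinarith) hw

/-- The bounding box of the cap has its extreme corner at `(t, -w)`. -/
theorem cap_lower {ξ ζ t w χ : ℝ} (hw : 0 ≤ w) (ht0 : 0 ≤ t) (ht : t ≤ ξ)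
    (h : ξ ^ 2 + ζ ^ 2 ≤ t ^ 2 + w ^ 2) (hs : 0 ≤ Real.sin χ) (hc : 0 ≤ Real.cos χ) :
    t * Real.cos χ - w * Real.sin χ ≤ ξ * Real.cos χ + ζ * Real.sin χ := by
  have h1 := (abs_le.1 (cap_abs_le hw ht0 ht h)).1
  have h2 := mul_le_mul_of_nonneg_right h1 hs
  have h3 := mul_le_mul_of_nonneg_right ht hc
  linarith

theorem proj_add (x y a χ : ℝ) :
    x * Real.cos (a + χ) + y * Real.sin (a + χ) =
      (x * Real.cos a + y * Real.sin a) * Real.cos χ +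
        (y * Real.cos a - x * Real.sin a) * Real.sin χ := by
  rw [Real.cos_add, Real.sin_add]; ring

theorem proj_sub (x y a χ : ℝ) :
    x * Real.cos (a - χ) + y * Real.sin (a - χ) =
      (x * Real.cos a + y * Real.sin a) * Real.cos χ +
        (-(y * Real.cos a - x * Real.sin a)) * Real.sin χ := by
  rw [Real.cos_sub, Real.sin_sub]; ring

theorem proj_sq_add_sq (x y a : ℝ) :
    (x * Real.cos a + y * Real.sin a) ^ 2 + (y * Real.cos a - x * Real.sin a) ^ 2 =
      x ^ 2 + y ^ 2 := by
  linear_combination (x ^ 2 + y ^ 2) * Real.sin_sq_add_cos_sq a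

/-- The direction ψ is at angle at least α from the normal to θ₀, and turning θ₀ by at most φ costs
at most φ of that angle. -/
theorem sin_sub_le_abs_cos {ψ θ θ₀ φ α : ℝ} (hφ : φ ≤ Real.pi / 2) (hα0 : 0 ≤ α)
    (hα : α ≤ Real.pi / 2) (h : Real.sin α ≤ |Real.cos (ψ - θ₀)|) (hθ : |θ - θ₀| ≤ φ) :
    Real.sin (α - φ) ≤ |Real.cos (ψ - θ)| := by
  have hs : 0 ≤ Real.sin α := Real.sin_nonneg_of_nonneg_of_le_pi hα0 (by linarith)
  have hc : 0 ≤ Real.cos α := Real.cos_nonneg_of_mem_Icc ⟨by linarith, hα⟩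
  have hsu : |Real.sin (ψ - θ₀)| ≤ Real.cos α := by
    refine abs_le_of_sq_le_sq ?_ hc
    have h1 : Real.sin α ^ 2 ≤ Real.cos (ψ - θ₀) ^ 2 := by
      rw [← sq_abs (Real.cos _)]; gcongr
    nlinarith [Real.sin_sq_add_cos_sq (ψ - θ₀), Real.sin_sq_add_cos_sq α]
  have hv := abs_nonneg (θ - θ₀)
  have hcv : Real.cos φ ≤ Real.cos (θ - θ₀) := by
    rw [← Real.cos_abs (θ - θ₀)]
    exact Real.cos_le_cos_of_nonneg_of_le_pi hv (by linarith [Real.pi_pos]) hθ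
  have hcφ : 0 ≤ Real.cos φ := Real.cos_nonneg_of_mem_Icc ⟨by linarith, hφ⟩
  have hsv : |Real.sin (θ - θ₀)| ≤ Real.sin φ := by
    rw [Real.abs_sin_eq_sin_abs_of_abs_le_pi (by linarith [Real.pi_pos])]
    exact Real.sin_le_sin_of_le_of_le_pi_div_two (by linarith) hφ hθ
  have e1 : ψ - θ = (ψ - θ₀) - (θ - θ₀) := by ring
  rw [e1, Real.cos_sub (ψ - θ₀), Real.sin_sub]
  have h3 : |Real.cos (ψ - θ₀) * Real.cos (θ - θ₀)| - |Real.sin (ψ - θ₀) * Real.sin (θ - θ₀)| ≤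
      |Real.cos (ψ - θ₀) * Real.cos (θ - θ₀) + Real.sin (ψ - θ₀) * Real.sin (θ - θ₀)| := by
    have := abs_sub_abs_le_abs_sub (Real.cos (ψ - θ₀) * Real.cos (θ - θ₀))
      (-(Real.sin (ψ - θ₀) * Real.sin (θ - θ₀)))
    rwa [abs_neg, sub_neg_eq_add] at this
  refine le_trans ?_ h3
  rw [abs_mul, abs_mul, abs_of_nonneg (hcφ.trans hcv)]
  have h4 : Real.sin α * Real.cos φ ≤ |Real.cos (ψ - θ₀)| * Real.cos (θ - θ₀) := by gcongr
  have h5 : |Real.sin (ψ - θ₀)| * |Real.sin (θ - θ₀)| ≤ Real.cos α * Real.sin φ := by gcongr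
  linarith

/-- Two families of segments in two caps, with good directions, force the total length to be
large. -/
theorem CoversDisc.caps_le {ι : Type*} [Fintype ι] {e : ℝ} {x y ψ : ι → ℝ}
    (he : 0 < e) (h : CoversDisc e x y ψ) {a κ t w η D : ℝ} {n : ℕ} (hw : 0 < w)
    (htw : w * Real.cos (Real.pi / 8) < t * Real.sin (Real.pi / 8)) (hη : 0 < η)
    (hκ1 : Real.pi / 8 ≤ κ) (hκ2 : κ ≤ Real.pi / 2) (hD : 0 < D) (P Q : Finset ι)
    (hP : P.card = n) (hQ : Q.card = n) (hn : n * e ≤ η)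
    (hPR : ∀ i ∈ P, x i ^ 2 + y i ^ 2 ≤ t ^ 2 + w ^ 2)
    (hQR : ∀ i ∈ Q, x i ^ 2 + y i ^ 2 ≤ t ^ 2 + w ^ 2)
    (hPt : ∀ i ∈ P, t ≤ x i * Real.cos a + y i * Real.sin a)
    (hQt : ∀ i ∈ Q, t ≤ x i * Real.cos (a + 2 * κ) + y i * Real.sin (a + 2 * κ))
    (hPd : ∀ i ∈ P, Real.sin (Real.pi / 8) ≤ |Real.cos (ψ i - (a + κ))|)
    (hQd : ∀ i ∈ Q, Real.sin (Real.pi / 8) ≤ |Real.cos (ψ i - (a + κ))|)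
    (hdist : ∀ i ∈ P, ∀ j ∈ Q, (x i - x j) ^ 2 + (y i - y j) ^ 2 ≤ D ^ 2) :
    (n * e) ^ 2 * (4 * Real.sin κ ^ 2 *
        (t * Real.sin (Real.pi / 8) - w * Real.cos (Real.pi / 8)) ^ 2) ≤
      2 * (e * Fintype.card ι - Real.pi) * D *
        ((2 * t * Real.sin κ + η * Real.cos (Real.pi / 8)) ^ 2 +
          (2 * w * Real.sin κ + η * Real.sin (Real.pi / 8)) ^ 2) := by
  have hpi := Real.pi_pos
  set s := Real.sin (Real.pi / 8) with hs
  set c := Real.cos (Real.pi / 8) with hc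
  have hs0 : 0 < s := Real.sin_pos_of_pos_of_lt_pi (by linarith) (by linarith)
  have hc0 : 0 < c := Real.cos_pos_of_mem_Ioo ⟨by linarith, by linarith⟩
  have ht : 0 < t := by
    by_contra hcon
    nlinarith [mul_pos hw hc0]
  have hsκ : 0 < Real.sin κ := Real.sin_pos_of_pos_of_lt_pi (by linarith) (by linarith)
  have hcκ : 0 ≤ Real.cos κ := Real.cos_nonneg_of_mem_Icc ⟨by linarith, hκ2⟩
  -- The argument φ of `z` is the turn at which the gap 2 sin κ (t sin φ - w cos φ) between the
  -- shadows of the caps equals η sin(π/8 - φ), the room that the shrunken shadows of length η need.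
  -- Solving for tan φ gives these coordinates.
  set z : ℂ := ⟨2 * t * Real.sin κ + η * c, 2 * w * Real.sin κ + η * s⟩ with hz
  have hzre : 0 < z.re := by simp only [hz]; positivity
  have hzim : 0 < z.im := by simp only [hz]; positivity
  have hz0 : z ≠ 0 := fun h0 => by simp [h0] at hzre
  set H := ‖z‖ with hH
  have hH0 : 0 < H := norm_pos_iff.2 hz0
  have hHsq : H ^ 2 = (2 * t * Real.sin κ + η * c) ^ 2 + (2 * w * Real.sin κ + η * s) ^ 2 := by
    rw [hH, ← Complex.normSq_eq_norm_sq, Complex.normSq_apply]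
    simp only [hz]
    ring
  set φ := z.arg with hφ
  have hcosφ : H * Real.cos φ = 2 * t * Real.sin κ + η * c := Complex.norm_mul_cos_arg z
  have hsinφ : H * Real.sin φ = 2 * w * Real.sin κ + η * s := Complex.norm_mul_sin_arg z
  have hφ0 : 0 ≤ φ := Complex.arg_nonneg_iff.2 hzim.le
  have hφ1 : φ < Real.pi / 2 := Complex.arg_lt_pi_div_two_iff.2 (Or.inl hzre)
  have hcφ0 : 0 < Real.cos φ := Real.cos_pos_of_mem_Ioo ⟨by linarith, hφ1⟩
  have hsφ0 : 0 ≤ Real.sin φ := Real.sin_nonneg_of_nonneg_of_le_pi hφ0 (by linarith)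
  set g := Real.sin (Real.pi / 8 - φ) with hg
  have hgH : H * g = 2 * Real.sin κ * (t * s - w * c) := by
    rw [hg, Real.sin_sub]
    linear_combination s * hcosφ - c * hsinφ
  have hg0 : 0 < g := by
    have : 0 < H * g := by rw [hgH]; exact mul_pos (by positivity) (by linarith)
    exact (mul_pos_iff_of_pos_left hH0).1 this
  have hφ8 : φ < Real.pi / 8 := by
    by_contra hcon
    have := Real.sin_nonpos_of_nonpos_of_neg_pi_le (x := Real.pi / 8 - φ) (by linarith)
      (by linarith)
    linarith
  have hmarg : 2 * Real.sin κ * (t * Real.sin φ - w * Real.cos φ) = η * g := by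
    have : H * (2 * Real.sin κ * (t * Real.sin φ - w * Real.cos φ)) = H * (η * g) := by
      linear_combination 2 * Real.sin κ * t * hsinφ - 2 * Real.sin κ * w * hcosφ - η * hgH
    exact mul_left_cancel₀ hH0.ne' this
  have htsφ : 0 ≤ t * Real.sin φ - w * Real.cos φ := by
    have : 0 ≤ 2 * Real.sin κ * (t * Real.sin φ - w * Real.cos φ) := by rw [hmarg]; positivity
    exact nonneg_of_mul_nonneg_right this (by positivity)
  have hng : n * (g * e) ≤ η * g := by
    have := mul_le_mul_of_nonneg_right hn hg0.le
    linarith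
  have hs1 : 0 ≤ Real.sin (κ - φ) :=
    Real.sin_nonneg_of_nonneg_of_le_pi (by linarith) (by linarith)
  have hc1 : 0 ≤ Real.cos (κ - φ) := Real.cos_nonneg_of_mem_Icc ⟨by linarith, by linarith⟩
  have hs2 : 0 ≤ Real.sin (κ + φ) :=
    Real.sin_nonneg_of_nonneg_of_le_pi (by linarith) (by linarith)
  have hc2 : w * Real.cos (κ + φ) ≤ t * Real.sin (κ + φ) := by
    rw [Real.cos_add, Real.sin_add]
    have h1 : 0 ≤ Real.sin κ * (t * Real.cos φ + w * Real.sin φ) := by positivity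
    have h2 := mul_nonneg hcκ htsφ
    linarith
  have hsep : (t * Real.cos (κ + φ) + w * Real.sin (κ + φ)) + n * (g * e) ≤
      t * Real.cos (κ - φ) - w * Real.sin (κ - φ) := by
    rw [Real.cos_add, Real.sin_add, Real.cos_sub, Real.sin_sub]
    linarith
  have main := h.facing_le he (θ₀ := a + κ) (φ := φ) (c := g) (D := D) hg0 hφ0 (by linarith) hD
    P Q hP hQ ?_ ?_ hdist
    (fun i hi θ hθ => sin_sub_le_abs_cos hφ1.le (by linarith) (by linarith) (hPd i hi) hθ)
    (fun i hi θ hθ => sin_sub_le_abs_cos hφ1.le (by linarith) (by linarith) (hQd i hi) hθ)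
  · rw [div_le_iff₀ hD] at main
    calc (n * e) ^ 2 * (4 * Real.sin κ ^ 2 * (t * s - w * c) ^ 2)
        = (n * (g * e)) ^ 2 * H ^ 2 := by
          linear_combination (-(n * e) ^ 2 * (H * g + 2 * Real.sin κ * (t * s - w * c))) * hgH
      _ ≤ 2 * (e * Fintype.card ι - Real.pi) * D * H ^ 2 := by gcongr
      _ = _ := by rw [hHsq]
  · intro i hi j hj
    have e1 : a + κ - φ = a + (κ - φ) := by ring
    have e2 : a + (κ - φ) = a + 2 * κ - (κ + φ) := by ring
    rw [e1, proj_add (x i), e2, proj_sub (x j)]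
    have hl := cap_lower hw.le ht.le (hPt i hi) (by rw [proj_sq_add_sq]; exact hPR i hi) hs1 hc1
    have hu := cap_upper hw (hQt j hj) (ζ := -(y j * Real.cos (a + 2 * κ) -
      x j * Real.sin (a + 2 * κ))) (by rw [neg_sq, proj_sq_add_sq]; exact hQR j hj) hs2 hc2
    linarith
  · intro i hi j hj
    have e1 : a + κ + φ = a + (κ + φ) := by ring
    have e2 : a + (κ + φ) = a + 2 * κ - (κ - φ) := by ring
    rw [e1, proj_add (x i), e2, proj_sub (x j)]
    have hu := cap_upper hw (hPt i hi) (by rw [proj_sq_add_sq]; exact hPR i hi) hs2 hc2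
    have hl := cap_lower hw.le ht.le (hQt j hj) (ζ := -(y j * Real.cos (a + 2 * κ) -
      x j * Real.sin (a + 2 * κ))) (by rw [neg_sq, proj_sq_add_sq]; exact hQR j hj) hs1 hc1
    linarith

/-! ### Usable directions and the choice of two rich caps -/

theorem sin_pi_div_eight_sq : Real.sin (Real.pi / 8) ^ 2 = (2 - √2) / 4 := by
  rw [Real.sin_pi_div_eight, div_pow, Real.sq_sqrt]
  · norm_num
  · nlinarith [Real.sq_sqrt (show (0 : ℝ) ≤ 2 by norm_num), Real.sqrt_nonneg 2]

theorem sqrt_two_bounds : (1.41 : ℝ) < √2 ∧ √2 < 1.42 := by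
  constructor
  · exact Real.lt_sqrt_of_sq_lt (by norm_num)
  · exact (Real.sqrt_lt' (by norm_num)).2 (by norm_num)

theorem cos_sq_lt_of_abs_cos_lt {ψ θ : ℝ} (h : |Real.cos (ψ - θ)| < Real.sin (Real.pi / 8)) :
    Real.cos (2 * ψ - 2 * θ) < -(√2 / 2) := by
  have h1 : Real.cos (ψ - θ) ^ 2 < (2 - √2) / 4 := by
    rw [← sin_pi_div_eight_sq, ← sq_abs (Real.cos _)]
    gcongr
  have e1 : 2 * ψ - 2 * θ = 2 * (ψ - θ) := by ring
  rw [e1, Real.cos_two_mul]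
  linarith

/-- A direction is close to at most one of four directions at mutual angles of at least `π / 4`. -/
theorem sin_le_abs_cos_or {ψ : ℝ} {j k : ℕ} (hj : j < 4) (hk : k < 4) (hjk : j ≠ k) :
    Real.sin (Real.pi / 8) ≤ |Real.cos (ψ - j * (Real.pi / 4))| ∨
      Real.sin (Real.pi / 8) ≤ |Real.cos (ψ - k * (Real.pi / 4))| := by
  by_contra! hcon
  -- After doubling angles the four directions are quarter turns. Two of ±cos 2ψ, ±sin 2ψ cannot
  -- both be below -√2/2: opposite signs exclude each other, and otherwise the squares would sum to
  -- more than 1.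
  have h1 := cos_sq_lt_of_abs_cos_lt hcon.1
  have h2 := cos_sq_lt_of_abs_cos_lt hcon.2
  have hsq := Real.sin_sq_add_cos_sq (2 * ψ)
  have h2sq := Real.sq_sqrt (show (0 : ℝ) ≤ 2 by norm_num)
  have hpos := Real.sqrt_nonneg 2
  have e0 : Real.cos (2 * ψ - 2 * ((0 : ℕ) * (Real.pi / 4))) = Real.cos (2 * ψ) := by simp
  have e1 : Real.cos (2 * ψ - 2 * ((1 : ℕ) * (Real.pi / 4))) = Real.sin (2 * ψ) := by
    rw [← Real.cos_sub_pi_div_two]; congr 1; push_cast; ring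
  have e2 : Real.cos (2 * ψ - 2 * ((2 : ℕ) * (Real.pi / 4))) = -Real.cos (2 * ψ) := by
    rw [← Real.cos_sub_pi]; congr 1; push_cast; ring
  have e3 : Real.cos (2 * ψ - 2 * ((3 : ℕ) * (Real.pi / 4))) = -Real.sin (2 * ψ) := by
    rw [← Real.cos_sub_pi_div_two, ← Real.cos_sub_pi]; congr 1; push_cast; ring
  interval_cases j <;> interval_cases k <;>
    first
    | exact absurd rfl hjk
    | (simp only [e0, e1, e2, e3] at h1 h2; nlinarith)

open Classical in
/-- The segments of a family with centre in a cap and direction not nearly orthogonal to a given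
one. -/
noncomputable def capSegments {ι : Type*} [Fintype ι] (x y ψ : ι → ℝ) (R t a θ : ℝ) : Finset ι :=
  Finset.univ.filter fun i => x i ^ 2 + y i ^ 2 ≤ R ^ 2 ∧
    t ≤ x i * Real.cos a + y i * Real.sin a ∧ Real.sin (Real.pi / 8) ≤ |Real.cos (ψ i - θ)|

theorem mem_capSegments {ι : Type*} [Fintype ι] {x y ψ : ι → ℝ} {R t a θ : ℝ} {i : ι} :
    i ∈ capSegments x y ψ R t a θ ↔ x i ^ 2 + y i ^ 2 ≤ R ^ 2 ∧
      t ≤ x i * Real.cos a + y i * Real.sin a ∧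
        Real.sin (Real.pi / 8) ≤ |Real.cos (ψ i - θ)| := by
  simp [capSegments]

theorem capSegments_add_two_pi {ι : Type*} [Fintype ι] (x y ψ : ι → ℝ) (R t a θ : ℝ) :
    capSegments x y ψ R t (a + 2 * Real.pi) θ = capSegments x y ψ R t a θ := by
  ext i; simp [mem_capSegments]

theorem capSegments_add_pi {ι : Type*} [Fintype ι] (x y ψ : ι → ℝ) (R t a θ : ℝ) :
    capSegments x y ψ R t a (θ + Real.pi) = capSegments x y ψ R t a θ := by
  ext i
  simp only [mem_capSegments, ← sub_sub, Real.cos_sub_pi, abs_neg]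

/-- In the frame of `a` both cross terms of the inner product are at least -Rw, since the transverse
coordinates are at most `w` in size. Adjacent caps thus beat the diameter 2R. -/
theorem dist_sq_le_of_adjacent_caps {x₁ y₁ x₂ y₂ a R t w : ℝ} (ht : 0 ≤ t) (hw : 0 ≤ w)
    (hR : 0 ≤ R) (hRtw : R ^ 2 = t ^ 2 + w ^ 2) (h₁ : x₁ ^ 2 + y₁ ^ 2 ≤ R ^ 2)
    (h₂ : x₂ ^ 2 + y₂ ^ 2 ≤ R ^ 2) (ht₁ : t ≤ x₁ * Real.cos a + y₁ * Real.sin a)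
    (ht₂ : t ≤ x₂ * Real.cos (a + 2 * (Real.pi / 4)) + y₂ * Real.sin (a + 2 * (Real.pi / 4))) :
    (x₁ - x₂) ^ 2 + (y₁ - y₂) ^ 2 ≤ 2 * R ^ 2 + 4 * R * w := by
  have e1 : 2 * (Real.pi / 4) = Real.pi / 2 := by ring
  rw [e1, Real.cos_add_pi_div_two, Real.sin_add_pi_div_two] at ht₂
  have f1 := proj_sq_add_sq x₁ y₁ a
  have f2 := proj_sq_add_sq x₂ y₂ a
  have f3 := proj_sq_add_sq (x₁ - x₂) (y₁ - y₂) a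
  set ξ₁ := x₁ * Real.cos a + y₁ * Real.sin a with hξ₁
  set ζ₁ := y₁ * Real.cos a - x₁ * Real.sin a with hζ₁
  set ξ₂ := y₂ * Real.cos a - x₂ * Real.sin a with hξ₂
  set ζ₂ := x₂ * Real.cos a + y₂ * Real.sin a with hζ₂
  have hc₁ := abs_le.1 (cap_abs_le hw ht ht₁ (ζ := ζ₁) (by linarith))
  have ht₂' : t ≤ ξ₂ := by linarith
  have hc₂ := abs_le.1 (cap_abs_le hw ht ht₂' (ζ := ζ₂) (by linarith))
  have g1 : ξ₁ ≤ R := abs_le_of_sq_le_sq' (by nlinarith [sq_nonneg ζ₁]) hR |>.2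
  have g2 : ξ₂ ≤ R := abs_le_of_sq_le_sq' (by nlinarith [sq_nonneg ζ₂]) hR |>.2
  have k1 : -(R * w) ≤ ξ₁ * ζ₂ := by nlinarith
  have k2 : -(R * w) ≤ ξ₂ * ζ₁ := by nlinarith
  have f4 : (x₁ - x₂) ^ 2 + (y₁ - y₂) ^ 2 = (ξ₁ - ζ₂) ^ 2 + (ζ₁ - ξ₂) ^ 2 := by
    rw [← f3, hξ₁, hζ₁, hξ₂, hζ₂]; ring
  rw [f4]
  nlinarith

theorem sin_pi_div_eight_bounds :
    0 < Real.sin (Real.pi / 8) ∧ Real.sin (Real.pi / 8) < 0.39 ∧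
      0.92 < Real.cos (Real.pi / 8) := by
  have h1 := sin_pi_div_eight_sq
  have h2 := Real.sin_sq_add_cos_sq (Real.pi / 8)
  have h3 := sqrt_two_bounds
  have hpi := Real.pi_pos
  have hs : 0 < Real.sin (Real.pi / 8) :=
    Real.sin_pos_of_pos_of_lt_pi (by linarith) (by linarith)
  have hc : 0 < Real.cos (Real.pi / 8) := Real.cos_pos_of_mem_Ioo ⟨by linarith, by linarith⟩
  refine ⟨hs, ?_, ?_⟩
  · exact lt_of_pow_lt_pow_left₀ 2 (by norm_num) (by linarith)
  · exact lt_of_pow_lt_pow_left₀ 2 hc.le (by linarith)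

theorem CoversDisc.excess_nonneg {ι : Type*} [Fintype ι] {e : ℝ} {x y ψ : ι → ℝ}
    (he : 0 < e) (h : CoversDisc e x y ψ) : 0 ≤ e * Fintype.card ι - Real.pi := by
  have h1 := h.integral_waste_le he (a := 0) (b := 0) le_rfl (by linarith [Real.pi_pos])
  rw [intervalIntegral.integral_same] at h1
  linarith

set_option maxHeartbeats 400000 in
/-- Rich opposite or adjacent caps force the total length to be large. -/
theorem CoversDisc.rich_caps_le {ι : Type*} [Fintype ι] {e : ℝ} {x y ψ : ι → ℝ}
    (he : 0 < e) (h : CoversDisc e x y ψ) {a κ R t w η : ℝ} (hR : 1 < R)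
    (ht0 : Real.cos (Real.pi / 8) * R < t) (hw : 0 < w)
    (hRtw : R ^ 2 = t ^ 2 + w ^ 2) (hη : 0 < η) (hη1 : η ≤ 0.04) (heη : e ≤ η)
    (hκ : κ = Real.pi / 4 ∨ κ = Real.pi / 2)
    (hP : η ≤ e * (capSegments x y ψ R t a (a + κ)).card)
    (hQ : η ≤ e * (capSegments x y ψ R t (a + 2 * κ) (a + κ)).card) :
    (η - e) ^ 2 * (4 * (t * Real.sin (Real.pi / 8) - w * Real.cos (Real.pi / 8)) ^ 2) ≤
      4 * R * (e * Fintype.card ι - Real.pi) *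
        ((2 * t + η * Real.cos (Real.pi / 8)) ^ 2 +
          (2 * w + η * Real.sin (Real.pi / 8)) ^ 2) := by
  obtain ⟨hs0, hs1, hc0⟩ := sin_pi_div_eight_bounds
  have hpi := Real.pi_pos
  have hδ := h.excess_nonneg he
  have hsc := Real.sin_sq_add_cos_sq (Real.pi / 8)
  set s := Real.sin (Real.pi / 8) with hs
  set c := Real.cos (Real.pi / 8) with hc
  set δ := e * Fintype.card ι - Real.pi with hδdef
  have ht : 0 < t := lt_trans (by nlinarith) ht0
  have hcR : 0 < c * R := by nlinarith
  have hwR : w < s * R := by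
    refine lt_of_pow_lt_pow_left₀ 2 (by nlinarith) ?_
    have : (c * R) ^ 2 < t ^ 2 := by gcongr
    nlinarith
  have htw : w * c < t * s := by nlinarith
  have hRw : R * w ≤ R * (0.39 * R) := by
    have : s * R ≤ 0.39 * R := by gcongr
    gcongr
    linarith
  have hRR : R ≤ R ^ 2 := by nlinarith
  set n := ⌊η / e⌋₊ with hn
  have hn1 : (n : ℝ) * e ≤ η := by
    rw [← le_div_iff₀ he]; exact Nat.floor_le (by positivity)
  have hn2 : η - e ≤ n * e := by
    have : η / e < n + 1 := Nat.lt_floor_add_one _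
    rw [div_lt_iff₀ he] at this
    linarith
  have hcard : ∀ T : Finset ι, η ≤ e * T.card → ∃ P ⊆ T, P.card = n := by
    intro T hT
    refine Finset.exists_subset_card_eq ?_
    have h1 : (n : ℝ) * e ≤ T.card * e := by linarith
    exact_mod_cast le_of_mul_le_mul_right h1 he
  obtain ⟨P, hPs, hPn⟩ := hcard _ hP
  obtain ⟨Q, hQs, hQn⟩ := hcard _ hQ
  have hPm := fun i hi => mem_capSegments.1 (hPs hi : i ∈ _)
  have hQm := fun i hi => mem_capSegments.1 (hQs hi : i ∈ _)
  have hκ1 : Real.pi / 8 ≤ κ := by rcases hκ with rfl | rfl <;> linarith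
  have hκ2 : κ ≤ Real.pi / 2 := by rcases hκ with rfl | rfl <;> linarith
  have key : ∀ D, 0 < D → (∀ i ∈ P, ∀ j ∈ Q, (x i - x j) ^ 2 + (y i - y j) ^ 2 ≤ D ^ 2) → _ :=
    fun D hD hdist => h.caps_le he (a := a) (κ := κ) hw htw hη hκ1 hκ2 hD P Q hPn hQn hn1
      (fun i hi => hRtw ▸ (hPm i hi).1) (fun i hi => hRtw ▸ (hQm i hi).1)
      (fun i hi => (hPm i hi).2.1) (fun i hi => (hQm i hi).2.1)
      (fun i hi => (hPm i hi).2.2) (fun i hi => (hQm i hi).2.2) hdist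
  have hne : (η - e) ^ 2 * (4 * (t * s - w * c) ^ 2) ≤ (n * e) ^ 2 * (4 * (t * s - w * c) ^ 2) := by
    have : 0 ≤ η - e := by linarith
    gcongr
  refine hne.trans ?_
  rcases hκ with rfl | rfl
  -- Adjacent caps: w < 0.39 R gives squared distance at most 3.56 R² < (1.9 R)². The shorter
  -- distance makes up for the smaller sin κ = √2/2, so the bound for opposite caps holds here too.
  · have h1 := key (1.9 * R) (by linarith) (fun i hi j hj => by
      have := dist_sq_le_of_adjacent_caps ht.le hw.le (by linarith) hRtw (hPm i hi).1 (hQm j hj).1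
        (hPm i hi).2.1 (hQm j hj).2.1
      linarith)
    rw [← hs, ← hc, ← hδdef, Real.sin_pi_div_four] at h1
    have hr := sqrt_two_bounds
    have hr2 := Real.sq_sqrt (show (0 : ℝ) ≤ 2 by norm_num)
    set r := √2
    have hy : t * c + w * s ≤ R := by
      refine abs_le_of_sq_le_sq' ?_ (by linarith) |>.2
      have : (t * c + w * s) ^ 2 = R ^ 2 - (t * s - w * c) ^ 2 := by
        linear_combination (t ^ 2 + w ^ 2) * hsc - hRtw
      linarith [sq_nonneg (t * s - w * c)]
    have hy0 : 0 ≤ t * c + w * s := by positivity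
    have e1 : (2 * t * (r / 2) + η * c) ^ 2 + (2 * w * (r / 2) + η * s) ^ 2 =
        2 * R ^ 2 + 2 * r * (η * (t * c + w * s)) + η ^ 2 := by
      linear_combination (t ^ 2 + w ^ 2) * hr2 - 2 * hRtw + η ^ 2 * hsc
    have e2 : (2 * t + η * c) ^ 2 + (2 * w + η * s) ^ 2 =
        4 * R ^ 2 + 4 * (η * (t * c + w * s)) + η ^ 2 := by
      linear_combination (-4) * hRtw + η ^ 2 * hsc
    have e3 : 4 * (r / 2) ^ 2 = 2 := by linear_combination hr2
    rw [e1, e3] at h1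
    rw [e2]
    have hηy : η * (t * c + w * s) ≤ 0.04 * R := by gcongr
    have hηy0 : 0 ≤ η * (t * c + w * s) := by positivity
    have hη2 : η ^ 2 ≤ 0.04 ^ 2 := by gcongr
    have hcmp : 7.6 * (2 * R ^ 2 + 2 * r * (η * (t * c + w * s)) + η ^ 2) ≤
        4 * (4 * R ^ 2 + 4 * (η * (t * c + w * s)) + η ^ 2) := by
      have : r * (η * (t * c + w * s)) ≤ 1.42 * (η * (t * c + w * s)) := by
        gcongr; exact hr.2.le
      linarith
    have := mul_le_mul_of_nonneg_left hcmp (show 0 ≤ R * δ by positivity)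
    linarith
  -- Opposite caps: the distance is at most the diameter of the disc of radius `R`.
  · have h1 := key (2 * R) (by linarith) (fun i hi j hj => by
      have := (hPm i hi).1
      have := (hQm j hj).1
      nlinarith [sq_nonneg (x i + x j), sq_nonneg (y i + y j)])
    rw [← hs, ← hc, ← hδdef, Real.sin_pi_div_two] at h1
    simp only [mul_one, one_pow] at h1
    linarith

/-- Every segment of the cap is outside radius `R` or usable for one of any two of the four
directions; what the outer segments leave is at least 2η, so one of the two gets η. -/
theorem card_capSegments_or {ι : Type*} [Fintype ι] {e : ℝ} {x y ψ : ι → ℝ}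
    (he : 0 < e) (h : CoversDisc e x y ψ) {a R t η : ℝ} (hR : 1 + e < R) (ht : 0 ≤ t)
    (hη : 2 * η ≤ 1 - t - e - (e * Fintype.card ι - Real.pi) / (1 - (1 + e) / R))
    {j k : ℕ} (hj : j < 4) (hk : k < 4) (hjk : j ≠ k) :
    η ≤ e * (capSegments x y ψ R t a (j * (Real.pi / 4))).card ∨
      η ≤ e * (capSegments x y ψ R t a (k * (Real.pi / 4))).card := by
  classical
  by_contra! hcon
  set G := fun j : ℕ => capSegments x y ψ R t a (j * (Real.pi / 4))
  set O := Finset.univ.filter fun i => R ^ 2 < x i ^ 2 + y i ^ 2 with hO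
  have h1 := h.le_card_cap he ht a (O ∪ (G j ∪ G k)) (fun i hi => by
    by_cases hi' : R ^ 2 < x i ^ 2 + y i ^ 2
    · exact Finset.mem_union_left _ (by simpa [hO] using hi')
    · refine Finset.mem_union_right _ ?_
      push Not at hi'
      rcases sin_le_abs_cos_or (ψ := ψ i) hj hk hjk with h1 | h1
      · exact Finset.mem_union_left _ (mem_capSegments.2 ⟨hi', hi, h1⟩)
      · exact Finset.mem_union_right _ (mem_capSegments.2 ⟨hi', hi, h1⟩))
  have h2 := h.card_outside_le he hR O (fun i hi => by simpa [hO] using hi)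
  have hpos : 0 < 1 - (1 + e) / R := by
    rw [sub_pos, div_lt_one (by linarith)]; exact hR
  rw [← le_div_iff₀ hpos] at h2
  have h3 : ((O ∪ (G j ∪ G k)).card : ℝ) ≤ O.card + ((G j).card + (G k).card) := by
    exact_mod_cast (Finset.card_union_le _ _).trans
      (Nat.add_le_add_left (Finset.card_union_le _ _) _)
  have h4 := mul_le_mul_of_nonneg_left h3 he.le
  have h5 := hcon.1
  have h6 := hcon.2
  simp only [G] at h4 h1
  linarith

/-- The quantitative bound for a family of short segments. -/
theorem CoversDisc.excess_ge {ι : Type*} [Fintype ι] {e : ℝ} {x y ψ : ι → ℝ}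
    (he : 0 < e) (h : CoversDisc e x y ψ) {R t w η : ℝ} (hR : 1 + e < R)
    (ht0 : Real.cos (Real.pi / 8) * R < t) (hw : 0 < w)
    (hRtw : R ^ 2 = t ^ 2 + w ^ 2) (hη : 0 < η) (heη : e ≤ η)
    (hη2 : 2 * η ≤ 1 - t - e - (e * Fintype.card ι - Real.pi) / (1 - (1 + e) / R)) :
    (η - e) ^ 2 * (4 * (t * Real.sin (Real.pi / 8) - w * Real.cos (Real.pi / 8)) ^ 2) ≤
      4 * R * (e * Fintype.card ι - Real.pi) *
        ((2 * t + η * Real.cos (Real.pi / 8)) ^ 2 +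
          (2 * w + η * Real.sin (Real.pi / 8)) ^ 2) := by
  have hR1 : 1 < R := by linarith
  have ht92 : 0.92 < t := by
    obtain ⟨-, -, hc⟩ := sin_pi_div_eight_bounds
    nlinarith
  have ht : 0 ≤ t := by linarith
  have hη1 : η ≤ 0.04 := by
    have hpos : 0 < 1 - (1 + e) / R := by
      rw [sub_pos, div_lt_one (by linarith)]; exact hR
    have := div_nonneg (h.excess_nonneg he) hpos.le
    linarith
  set A : ℕ → ℕ → Prop := fun j k =>
    η ≤ e * (capSegments x y ψ R t (j * (Real.pi / 2)) (k * (Real.pi / 4))).card with hA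
  have hor : ∀ i j k : ℕ, j < 4 → k < 4 → j ≠ k → A i j ∨ A i k := fun i j k hj hk hjk =>
    card_capSegments_or he h hR ht hη2 hj hk hjk
  have hpair : ∀ {a κ : ℝ}, κ = Real.pi / 4 ∨ κ = Real.pi / 2 → _ → _ → _ := fun {a κ} hκ hP hQ =>
    h.rich_caps_le he (a := a) (κ := κ) hR1 ht0 hw hRtw hη hη1 heη hκ hP hQ
  -- Each cap lacks at most one direction. If both opposite pairs fail, some cap of {0, 2} lacks
  -- direction 2 and some cap of {1, 3} lacks direction 0. These two caps are adjacent and have both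
  -- odd directions, one of which is their bisector modulo π.
  have hcases : (A 0 1 ∧ A 1 1) ∨ (A 1 3 ∧ A 2 3) ∨ (A 2 1 ∧ A 3 1) ∨ (A 3 3 ∧ A 0 3) ∨
      (A 0 2 ∧ A 2 2) ∨ (A 1 0 ∧ A 3 0) := by
    have a1 := hor 0 1 2 (by norm_num) (by norm_num) (by norm_num)
    have a2 := hor 0 1 3 (by norm_num) (by norm_num) (by norm_num)
    have a3 := hor 0 2 3 (by norm_num) (by norm_num) (by norm_num)
    have b1 := hor 1 0 1 (by norm_num) (by norm_num) (by norm_num)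
    have b2 := hor 1 0 3 (by norm_num) (by norm_num) (by norm_num)
    have b3 := hor 1 1 3 (by norm_num) (by norm_num) (by norm_num)
    have c1 := hor 2 1 2 (by norm_num) (by norm_num) (by norm_num)
    have c2 := hor 2 1 3 (by norm_num) (by norm_num) (by norm_num)
    have c3 := hor 2 2 3 (by norm_num) (by norm_num) (by norm_num)
    have d1 := hor 3 0 1 (by norm_num) (by norm_num) (by norm_num)
    have d2 := hor 3 0 3 (by norm_num) (by norm_num) (by norm_num)
    have d3 := hor 3 1 3 (by norm_num) (by norm_num) (by norm_num)
    clear_value A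
    grind
  have hrw : ∀ {a a' θ θ' : ℝ}, a = a' → θ = θ' → η ≤ e * (capSegments x y ψ R t a θ).card →
      η ≤ e * (capSegments x y ψ R t a' θ').card := by
    rintro a _ θ _ rfl rfl h; exact h
  have hrwπ : ∀ {a a' θ θ' : ℝ}, a = a' → θ = θ' + Real.pi →
      η ≤ e * (capSegments x y ψ R t a θ').card →
      η ≤ e * (capSegments x y ψ R t a' θ).card := by
    rintro a _ _ θ rfl rfl h; rwa [capSegments_add_pi]
  rcases hcases with ⟨h1, h2⟩ | ⟨h1, h2⟩ | ⟨h1, h2⟩ | ⟨h1, h2⟩ | ⟨h1, h2⟩ | ⟨h1, h2⟩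
  · exact hpair (a := 0) (Or.inl rfl) (hrw (by norm_num) (by norm_num) h1)
      (hrw (by push_cast; ring) (by push_cast; ring) h2)
  · exact hpair (a := Real.pi / 2) (Or.inl rfl) (hrw (by push_cast; ring) (by push_cast; ring) h1)
      (hrw (by push_cast; ring) (by push_cast; ring) h2)
  · exact hpair (a := Real.pi) (Or.inl rfl) (hrwπ (by push_cast; ring) (by push_cast; ring) h1)
      (hrwπ (by push_cast; ring) (by push_cast; ring) h2)
  · refine hpair (a := 3 * (Real.pi / 2)) (Or.inl rfl)
      (hrwπ (by push_cast; ring) (by push_cast; ring) h1) ?_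
    rw [show 3 * (Real.pi / 2) + 2 * (Real.pi / 4) = (0 : ℕ) * (Real.pi / 2) + 2 * Real.pi by
      push_cast; ring, capSegments_add_two_pi]
    exact hrwπ rfl (by push_cast; ring) h2
  · exact hpair (a := 0) (Or.inr rfl) (hrw (by norm_num) (by push_cast; ring) h1)
      (hrw (by push_cast; ring) (by push_cast; ring) h2)
  · exact hpair (a := Real.pi / 2) (Or.inr rfl)
      (hrwπ (by push_cast; ring) (by push_cast; ring) h1)
      (hrwπ (by push_cast; ring) (by push_cast; ring) h2)

/-! ### Passage to the limit of short segments -/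

open Filter Topology in
/-- A straight barrier for the unit disc is not shorter than half the perimeter of the disc. -/
theorem IsStraightBarrier.pi_le_planeLength {B : Set Plane} (hB : IsStraightBarrier unitDisc B) :
    Real.pi ≤ planeLength B := by
  obtain ⟨K, -, h⟩ := hB.exists_coversDisc
  have hlim : Tendsto (fun e : ℝ => planeLength B + K * e) (𝓝[>] 0) (𝓝 (planeLength B + K * 0)) :=
    ((by fun_prop : Continuous fun e : ℝ => planeLength B + K * e).tendsto 0).mono_left
      nhdsWithin_le_nhds
  rw [mul_zero, add_zero] at hlim
  refine ge_of_tendsto hlim (eventually_nhdsWithin_of_forall fun e he => ?_)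
  obtain ⟨ι, _, x, y, ψ, hlen, hcov⟩ := h e he
  linarith [hcov.excess_nonneg he]

-- The strict inequality on η survives for all small `e`, where the finite bound applies; both sides
-- of that bound are continuous in `e`.
open Filter Topology in
theorem IsStraightBarrier.excess_ge {B : Set Plane} (hB : IsStraightBarrier unitDisc B)
    {R t w η : ℝ} (hR : 1 < R) (ht0 : Real.cos (Real.pi / 8) * R < t) (hw : 0 < w)
    (hRtw : R ^ 2 = t ^ 2 + w ^ 2) (hη : 0 < η)
    (hη2 : 2 * η < 1 - t - (planeLength B - Real.pi) / (1 - 1 / R)) :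
    η ^ 2 * (4 * (t * Real.sin (Real.pi / 8) - w * Real.cos (Real.pi / 8)) ^ 2) ≤
      4 * R * (planeLength B - Real.pi) *
        ((2 * t + η * Real.cos (Real.pi / 8)) ^ 2 +
          (2 * w + η * Real.sin (Real.pi / 8)) ^ 2) := by
  obtain ⟨K, -, h⟩ := hB.exists_coversDisc
  set L := planeLength B
  have hR0 : R ≠ 0 := by positivity
  have h1R : 1 - (1 + 0) / R ≠ 0 := by
    rw [add_zero]
    exact (sub_pos.2 ((div_lt_one (by linarith)).2 hR)).ne'
  have hcont : ContinuousAt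
      (fun e : ℝ => 1 - t - e - (L + K * e - Real.pi) / (1 - (1 + e) / R)) 0 := by
    refine ContinuousAt.sub (by fun_prop) (ContinuousAt.div (by fun_prop) ?_ h1R)
    exact continuousAt_const.sub (ContinuousAt.div_const (by fun_prop) R)
  have hev1 : ∀ᶠ e in 𝓝[>] (0 : ℝ),
      2 * η < 1 - t - e - (L + K * e - Real.pi) / (1 - (1 + e) / R) := by
    refine (hcont.eventually_const_lt ?_).filter_mono nhdsWithin_le_nhds
    simpa using hη2
  have hev2 : ∀ᶠ e in 𝓝[>] (0 : ℝ), e < η :=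
    (eventually_lt_nhds hη).filter_mono nhdsWithin_le_nhds
  have hev3 : ∀ᶠ e in 𝓝[>] (0 : ℝ), e < R - 1 :=
    (eventually_lt_nhds (by linarith)).filter_mono nhdsWithin_le_nhds
  have hlim1 : Tendsto (fun e : ℝ => (η - e) ^ 2 *
      (4 * (t * Real.sin (Real.pi / 8) - w * Real.cos (Real.pi / 8)) ^ 2)) (𝓝[>] 0)
      (𝓝 ((η - 0) ^ 2 *
      (4 * (t * Real.sin (Real.pi / 8) - w * Real.cos (Real.pi / 8)) ^ 2))) :=
    (Continuous.tendsto (by fun_prop) 0).mono_left nhdsWithin_le_nhds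
  have hlim2 : Tendsto (fun e : ℝ => 4 * R * (L + K * e - Real.pi) *
        ((2 * t + η * Real.cos (Real.pi / 8)) ^ 2 +
          (2 * w + η * Real.sin (Real.pi / 8)) ^ 2)) (𝓝[>] 0)
      (𝓝 (4 * R * (L + K * 0 - Real.pi) *
        ((2 * t + η * Real.cos (Real.pi / 8)) ^ 2 +
          (2 * w + η * Real.sin (Real.pi / 8)) ^ 2))) :=
    (Continuous.tendsto (by fun_prop) 0).mono_left nhdsWithin_le_nhds
  rw [sub_zero] at hlim1
  rw [mul_zero, add_zero] at hlim2
  refine le_of_tendsto_of_tendsto hlim1 hlim2 ?_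
  filter_upwards [hev1, hev2, hev3, self_mem_nhdsWithin] with e he1 he2 he3 he
  have he0 : 0 < e := he
  obtain ⟨ι, _, x, y, ψ, hlen, hcov⟩ := h e he0
  have hpos : 0 < 1 - (1 + e) / R := by
    rw [sub_pos, div_lt_one (by linarith)]; linarith
  have hle : e * Fintype.card ι - Real.pi ≤ L + K * e - Real.pi := by linarith
  have hdiv : (e * Fintype.card ι - Real.pi) / (1 - (1 + e) / R) ≤
      (L + K * e - Real.pi) / (1 - (1 + e) / R) := by gcongr
  refine (hcov.excess_ge he0 (by linarith) ht0 hw hRtw hη he2.le (by linarith)).trans ?_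
  gcongr

theorem theorem3 (B : Set Plane) (hB : IsStraightBarrier unitDisc B)
    (r t : ℝ) (hr0 : 0 < r) (hr1 : r < 1 / Real.cos (Real.pi / 8) - 1)
    (ht0 : Real.cos (Real.pi / 8) * (1 + r) < t) (ht1 : t ≤ 1)
    (δ w η' h' : ℝ)
    (hδ : δ = planeLength B - Real.pi)
    (hw : w = Real.sqrt ((1 + r) ^ 2 - t ^ 2))
    (hη' : η' = (1 / 2) * (1 - t - (1 + r) / r * δ))
    (hh' : h' = (η' + 2 * t * Real.cos (Real.pi / 8) + 2 * w * Real.sin (Real.pi / 8)) /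
      (2 * t * Real.sin (Real.pi / 8) - 2 * w * Real.cos (Real.pi / 8)))
    (hη'_nonneg : 0 ≤ η') :
    4 * (1 + r) * (1 + h' ^ 2) * δ ≥ η' ^ 2 := by
  obtain ⟨hs0, -, hc0⟩ := sin_pi_div_eight_bounds
  have hsc := Real.sin_sq_add_cos_sq (Real.pi / 8)
  have hδ0 : 0 ≤ δ := by rw [hδ, sub_nonneg]; exact hB.pi_le_planeLength
  rcases hη'_nonneg.eq_or_lt with h0 | hpos
  · rw [← h0, ge_iff_le, zero_pow two_ne_zero]
    positivity
  have ht : 0 < t := lt_trans (by positivity) ht0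
  have hw0 : 0 < w := by
    rw [hw]
    exact Real.sqrt_pos.2 (by nlinarith)
  have hRtw : (1 + r) ^ 2 = t ^ 2 + w ^ 2 := by
    rw [hw, Real.sq_sqrt (by nlinarith)]; ring
  -- Values below `η'` supply the strict inequality needed; `η'` itself is reached by continuity.
  have hlim : ∀ η, 0 < η → η < η' →
      η ^ 2 * (4 * (t * Real.sin (Real.pi / 8) - w * Real.cos (Real.pi / 8)) ^ 2) ≤
      4 * (1 + r) * δ * ((2 * t + η * Real.cos (Real.pi / 8)) ^ 2 +
          (2 * w + η * Real.sin (Real.pi / 8)) ^ 2) := by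
    intro η h1 h2
    rw [hδ]
    refine hB.excess_ge (by linarith) ht0 hw0 hRtw h1 ?_
    have e1 : (planeLength B - Real.pi) / (1 - 1 / (1 + r)) = (1 + r) / r * δ := by
      have e2 : 1 - 1 / (1 + r) = r / (1 + r) := by
        rw [one_sub_div (by positivity)]; ring
      rw [e2, ← hδ, div_div_eq_mul_div, div_mul_eq_mul_div, mul_comm]
    rw [e1]
    linarith
  have key : η' ^ 2 * (4 * (t * Real.sin (Real.pi / 8) - w * Real.cos (Real.pi / 8)) ^ 2) ≤
      4 * (1 + r) * δ * ((2 * t + η' * Real.cos (Real.pi / 8)) ^ 2 +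
          (2 * w + η' * Real.sin (Real.pi / 8)) ^ 2) := by
    refine le_of_tendsto_of_tendsto (b := nhdsWithin η' (Set.Iio η'))
      (f := fun η => η ^ 2 *
        (4 * (t * Real.sin (Real.pi / 8) - w * Real.cos (Real.pi / 8)) ^ 2))
      (g := fun η => 4 * (1 + r) * δ * ((2 * t + η * Real.cos (Real.pi / 8)) ^ 2 +
          (2 * w + η * Real.sin (Real.pi / 8)) ^ 2))
      ((Continuous.tendsto (by fun_prop) η').mono_left nhdsWithin_le_nhds)
      ((Continuous.tendsto (by fun_prop) η').mono_left nhdsWithin_le_nhds) ?_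
    filter_upwards [Ioo_mem_nhdsLT hpos] with η hη
    exact hlim η hη.1 hη.2
  set s := Real.sin (Real.pi / 8)
  set c := Real.cos (Real.pi / 8)
  have htw : w * c < t * s := by
    refine lt_of_pow_lt_pow_left₀ 2 (by positivity) ?_
    have h1 : (c * (1 + r)) ^ 2 < t ^ 2 := by gcongr
    have h2 : (t * s) ^ 2 - (w * c) ^ 2 = t ^ 2 - (c * (1 + r)) ^ 2 := by
      linear_combination t ^ 2 * hsc + c ^ 2 * hRtw
    linarith
  have hD : 0 < 2 * t * s - 2 * w * c := by linarith
  -- With cot(π/8 - φ) = `h'`, this is 1 + cot² = 1/sin²; algebraically, the Lagrange identity for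
  -- two plane vectors, one of them (c, s).
  have hfrac : 1 + h' ^ 2 = ((2 * t + η' * c) ^ 2 + (2 * w + η' * s) ^ 2) /
      (2 * t * s - 2 * w * c) ^ 2 := by
    rw [hh', div_pow, eq_div_iff (by positivity), add_mul, div_mul_cancel₀ _ (by positivity)]
    linear_combination (4 * t ^ 2 + 4 * w ^ 2 - η' ^ 2) * hsc
  rw [ge_iff_le, hfrac, mul_div_assoc', div_mul_eq_mul_div, le_div_iff₀ (by positivity)]
  linarith
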